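/- Fix $d\ge 1$ and let $$\Theta_1=\{\theta\in\mathbb R^d:\ \theta\neq 0\text{ and the first nonzero coordinate of }\theta\text{ is positive}\},$$ and let the true parameter $\theta_0$ lie in the interior of $\Theta_1$ (that is, its first coordinate is positive; for $d=1$ this is all of $\Theta_1$). For every $n$ let $Q_0=Q_0^{(n)}$ be an arbitrary probability measure on $\{-1,1\}^n$, and let $X^n=(X_1,\dots,X_n)$ be generated by $Z^n=(Z_1,\dots,Z_n)\sim Q_0$ and, conditionally on $Z^n$, independent $X_i\sim N_d(\theta_0 Z_i, I_d)$, $i=1,\dots,n$. Let $$N_n(\theta)=\frac{\theta^\top\theta}{2}-\frac1n\sum_{i=1}^n\log\cosh(\theta^\top X_i),\qquad I_0(\theta_0)=I_d-\mathbb E_{X\sim N_d(\theta_0,I_d)}\big[XX^\top\operatorname{sech}^2(\theta_0^\top X)\big].$$ Then the following hold. (a) With probability tending to one as $n\to\infty$, $N_n$ has a unique minimiser over $\Theta_1$; and $I_0(\theta_0)$ is positive definite. (b) Let $\hat\theta_n^{\mathrm{iid}}=\operatorname{argmin}_{\theta\in\Theta_1}N_n(\theta)$, meaning any measurable function of $X^n$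 that minimises $N_n$ over $\Theta_1$ whenever a minimiser exists (and is arbitrary otherwise). Then $$\sqrt n\,(\hat\theta_n^{\mathrm{iid}}-\theta_0)=I_0(\theta_0)^{-1}\frac1{\sqrt n}\sum_{i=1}^n\big(X_i\tanh(\theta_0^\top X_i)-\theta_0\big)+o_p(1),$$ where $o_p(1)$ denotes a term that converges to $0$ in probability as $n\to\infty$. (c) Moreover $\sqrt n\,(\hat\theta_n^{\mathrm{iid}}-\theta_0)\xrightarrow{d}N_d\big(0,I_0(\theta_0)^{-1}\big)$. -/

import Mathlib

open MeasureTheory ProbabilityTheory Filter Topology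

noncomputable section

namespace LabelMixture

/-- The half-space `Θ₁ ⊆ ℝ^d`: the vectors whose first nonzero coordinate exists and is
positive. -/
def halfSpace (d : ℕ) : Set (EuclideanSpace ℝ (Fin d)) :=
  {θ | ∃ k : Fin d, 0 < θ k ∧ ∀ j : Fin d, j < k → θ j = 0}

/-- The law of `X^n = (X_1, …, X_n)` when the labels `Z^n ∈ {-1, 1}^n` have joint law `Q` and,
given `Z^n = z`, the `X_i` are independent with `X_i ∼ N_d(z_i θ, I_d)`. -/
def mixtureLaw {d n : ℕ} (θ : EuclideanSpace ℝ (Fin d)) (Q : PMF (Fin n → ℤˣ)) :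
    Measure (Fin n → EuclideanSpace ℝ (Fin d)) :=
  ∑ z : Fin n → ℤˣ,
    Q z • Measure.pi fun i => multivariateGaussian (((z i : ℤ) : ℝ) • θ) 1

/-- The criterion `N_n(θ) = θᵀθ / 2 - (1/n) ∑ log cosh(θᵀ X_i)` for the data `x`. -/
def criterion {d n : ℕ} (x : Fin n → EuclideanSpace ℝ (Fin d)) (θ : EuclideanSpace ℝ (Fin d)) :
    ℝ :=
  inner ℝ θ θ / 2 - (1 / (n : ℝ)) * ∑ i, Real.log (Real.cosh (inner ℝ θ (x i)))

/-- `θ` minimises the criterion over the half-space `Θ₁`. -/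
def IsMinimiser {d n : ℕ} (x : Fin n → EuclideanSpace ℝ (Fin d)) (θ : EuclideanSpace ℝ (Fin d)) :
    Prop :=
  θ ∈ halfSpace d ∧ IsMinOn (criterion x) (halfSpace d) θ

/-- The matrix `I₀(θ) = I_d - E[X Xᵀ sech²(θᵀ X)]` with `X ∼ N_d(θ, I_d)`. -/
def info {d : ℕ} (θ : EuclideanSpace ℝ (Fin d)) : Matrix (Fin d) (Fin d) ℝ :=
  1 - Matrix.of fun j k =>
    ∫ x : EuclideanSpace ℝ (Fin d), x j * x k * (1 / Real.cosh (inner ℝ θ x)) ^ 2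
      ∂(multivariateGaussian θ 1)

/-- The leading term `I₀(θ)⁻¹ n^{-1/2} ∑ (X_i tanh(θᵀ X_i) - θ)` of the expansion. -/
def leadingTerm {d n : ℕ} (θ : EuclideanSpace ℝ (Fin d)) (x : Fin n → EuclideanSpace ℝ (Fin d)) :
    EuclideanSpace ℝ (Fin d) :=
  Matrix.toEuclideanCLM (𝕜 := ℝ) (info θ)⁻¹
    ((1 / √(n : ℝ)) • ∑ i, (Real.tanh (inner ℝ θ (x i)) • x i - θ))

end LabelMixture

end

open MeasureTheory ProbabilityTheory Filter Topology

namespace LabelMixture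

variable {d n : ℕ}

/-! The criterion, the score and the curvature are even in every observation. Flipping signs turns
N(zθ₀, I) into N(θ₀, I), so statistics built from them have the same law for every label
distribution, and the `X_i` may be taken i.i.d. N(θ₀, I) (`map_mixtureLaw`).

Up to a constant the criterion is the mean negative log-likelihood of the symmetric mixture of N(θ,
I) and N(-θ, I). Its population excess over θ₀ is a Kullback–Leibler divergence, so it is minimal
only at ±θ₀ (`populationCriterion_lt`), and the half-space selects θ₀. Uniform laws of large numbers
for the criterion and its Hessian (`tendsto_mixtureLaw_uniform`) place a global minimiser near θ₀.
There the Hessian is close to the invertible I₀, so the gradient is injective: this gives uniqueness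
(`exists_unique_isMinimiser`) and, by linearising the score equation, the expansion with a small
relative error (`norm_expansion_le`).

The score is centred with covariance I₀ (`integral_inner_score_sq`), so the central limit theorem
gives the leading term covariance I₀⁻¹ I₀ I₀⁻¹ = I₀⁻¹. It is therefore bounded in probability, which
makes the relative error an absolute one, and Slutsky's lemma transfers the limit to the estimator.
-/

theorem hasDerivAt_tanh (x : ℝ) : HasDerivAt Real.tanh ((1 / Real.cosh x) ^ 2) x := by
  have h := (Real.hasDerivAt_sinh x).div (Real.hasDerivAt_cosh x) (Real.cosh_pos x).ne'
  refine (h.congr_of_eventuallyEq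
    (Eventually.of_forall fun y => Real.tanh_eq_sinh_div_cosh y)).congr_deriv ?_
  rw [one_div, inv_pow, ← one_div, ← Real.cosh_sq_sub_sinh_sq x]
  ring

theorem continuous_tanh : Continuous Real.tanh :=
  continuous_iff_continuousAt.2 fun x => (hasDerivAt_tanh x).continuousAt

/-! ### The Gaussian measure `N(θ, I)` as an exponential tilt of the standard Gaussian -/

/-- The integrand factors over coordinates into one-dimensional complex moment generating functions.
The case b = 0 gives the normalising constant of the tilt, general b its characteristic function. -/
theorem integral_cexp_inner_stdGaussian (a b : EuclideanSpace ℝ (Fin d)) :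
    ∫ x, Complex.exp ((inner ℝ x a : ℝ) + (inner ℝ x b : ℝ) * Complex.I)
      ∂(stdGaussian (EuclideanSpace ℝ (Fin d))) =
      Complex.exp (∑ k, ((a k : ℂ) + (b k : ℂ) * Complex.I) ^ 2 / 2) := by
  rw [← map_pi_eq_stdGaussian, integral_map (by fun_prop) (by fun_prop)]
  have h : ∀ x : Fin d → ℝ,
      Complex.exp ((inner ℝ (WithLp.toLp 2 x) a : ℝ) +
        (inner ℝ (WithLp.toLp 2 x) b : ℝ) * Complex.I) =
      ∏ k, Complex.exp (((a k : ℂ) + (b k : ℂ) * Complex.I) * ((x k : ℝ) : ℂ)) := by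
    intro x
    rw [← Complex.exp_sum]
    congr 1
    simp only [PiLp.inner_apply, RCLike.inner_apply, conj_trivial, Complex.ofReal_sum,
      Complex.ofReal_mul, Finset.sum_mul]
    rw [← Finset.sum_add_distrib]
    exact Finset.sum_congr rfl fun k _ => by ring
  simp_rw [h]
  rw [integral_fintype_prod_eq_prod
    (f := fun k (x : ℝ) => Complex.exp (((a k : ℂ) + (b k : ℂ) * Complex.I) * (x : ℂ)))]
  rw [Complex.exp_sum]
  refine Finset.prod_congr rfl fun k _ => ?_
  have := complexMGF_id_gaussianReal (μ := 0) (v := 1) ((a k : ℂ) + (b k : ℂ) * Complex.I)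
  simpa [complexMGF] using this

theorem integral_exp_inner_stdGaussian (a : EuclideanSpace ℝ (Fin d)) :
    ∫ x, Real.exp (inner ℝ a x) ∂(stdGaussian (EuclideanSpace ℝ (Fin d))) =
      Real.exp (‖a‖ ^ 2 / 2) := by
  have h := integral_cexp_inner_stdGaussian a 0
  simp only [inner_zero_right, Complex.ofReal_zero, zero_mul, add_zero, PiLp.zero_apply] at h
  have h2 : ∀ x : EuclideanSpace ℝ (Fin d), Complex.exp ((inner ℝ x a : ℝ) : ℂ) =
      ((Real.exp (inner ℝ a x) : ℝ) : ℂ) := by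
    intro x; rw [real_inner_comm, Complex.ofReal_exp]
  simp_rw [h2] at h
  rw [integral_complex_ofReal] at h
  rw [← Complex.ofReal_inj, h, EuclideanSpace.real_norm_sq_eq]
  push_cast
  rw [Finset.sum_div]

theorem integrable_exp_inner_stdGaussian (a : EuclideanSpace ℝ (Fin d)) :
    Integrable (fun x => Real.exp (inner ℝ a x)) (stdGaussian (EuclideanSpace ℝ (Fin d))) := by
  -- A non-integrable function has Bochner integral 0, whereas this integral is a positive
  -- exponential.
  by_contra h
  have := integral_exp_inner_stdGaussian a
  rw [integral_undef h] at this
  exact (Real.exp_pos _).ne this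

/-- With N(θ, I) written as a weight on a symmetric measure, parity arguments under x ↦ -x become
available. -/
theorem multivariateGaussian_one_eq_tilted (θ : EuclideanSpace ℝ (Fin d)) :
    multivariateGaussian θ 1 =
      (stdGaussian (EuclideanSpace ℝ (Fin d))).tilted fun x => inner ℝ θ x := by
  have := isProbabilityMeasure_tilted (integrable_exp_inner_stdGaussian θ)
  refine Measure.ext_of_charFun (funext fun t => ?_)
  rw [charFun_multivariateGaussian Matrix.PosSemidef.one, charFun_apply, integral_tilted,
    integral_exp_inner_stdGaussian]
  have h : ∀ x : EuclideanSpace ℝ (Fin d),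
      (Real.exp (inner ℝ θ x) / Real.exp (‖θ‖ ^ 2 / 2)) •
        Complex.exp ((inner ℝ x t : ℝ) * Complex.I) =
      Complex.exp (-(‖θ‖ ^ 2 / 2 : ℝ)) *
        Complex.exp ((inner ℝ x θ : ℝ) + (inner ℝ x t : ℝ) * Complex.I) := by
    intro x
    rw [Complex.real_smul, ← Real.exp_sub, Complex.ofReal_exp, ← Complex.exp_add,
      ← Complex.exp_add, real_inner_comm]
    congr 1
    push_cast
    ring
  simp_rw [h]
  rw [integral_const_mul, integral_cexp_inner_stdGaussian, ← Complex.exp_add]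
  congr 1
  simp only [Matrix.one_mulVec, dotProduct, PiLp.inner_apply, RCLike.inner_apply, conj_trivial,
    EuclideanSpace.real_norm_sq_eq]
  push_cast
  rw [Finset.sum_mul, Finset.sum_div, Finset.sum_div, ← Finset.sum_neg_distrib,
    ← Finset.sum_sub_distrib, ← Finset.sum_add_distrib]
  refine Finset.sum_congr rfl fun k _ => ?_
  linear_combination (-(t k : ℂ) ^ 2 / 2) * Complex.I_sq

theorem integral_multivariateGaussian_one {F : Type*} [NormedAddCommGroup F] [NormedSpace ℝ F]
    (θ : EuclideanSpace ℝ (Fin d)) (g : EuclideanSpace ℝ (Fin d) → F) :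
    ∫ x, g x ∂(multivariateGaussian θ 1) =
      Real.exp (-(‖θ‖ ^ 2 / 2)) • ∫ x, Real.exp (inner ℝ θ x) • g x
        ∂(stdGaussian (EuclideanSpace ℝ (Fin d))) := by
  rw [multivariateGaussian_one_eq_tilted, integral_tilted, integral_exp_inner_stdGaussian,
    ← integral_smul]
  refine integral_congr_ae (ae_of_all _ fun x => ?_)
  simp only [smul_smul]
  rw [Real.exp_neg, div_eq_inv_mul]

theorem integral_neg_stdGaussian {F : Type*} [NormedAddCommGroup F] [NormedSpace ℝ F]
    (g : EuclideanSpace ℝ (Fin d) → F) :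
    ∫ x, g (-x) ∂(stdGaussian (EuclideanSpace ℝ (Fin d))) =
      ∫ x, g x ∂(stdGaussian (EuclideanSpace ℝ (Fin d))) := by
  have h := stdGaussian_map (LinearIsometryEquiv.neg ℝ (E := EuclideanSpace ℝ (Fin d)))
  conv_rhs => rw [← h]
  exact (integral_map_equiv
    (LinearIsometryEquiv.neg ℝ (E := EuclideanSpace ℝ (Fin d))).toHomeomorph.toMeasurableEquiv
    g).symm

/-- For an even weight, the tilted integral against `1 / cosh` untilts. -/
theorem integral_div_cosh_multivariateGaussian (θ : EuclideanSpace ℝ (Fin d))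
    {k : EuclideanSpace ℝ (Fin d) → ℝ} (hk : ∀ x, k (-x) = k x)
    (hint : Integrable k (stdGaussian (EuclideanSpace ℝ (Fin d)))) :
    ∫ x, k x / Real.cosh (inner ℝ θ x) ∂(multivariateGaussian θ 1) =
      Real.exp (-(‖θ‖ ^ 2 / 2)) * ∫ x, k x ∂(stdGaussian (EuclideanSpace ℝ (Fin d))) := by
  rw [integral_multivariateGaussian_one, smul_eq_mul]
  congr 1
  -- Since exp u / cosh u = 1 + tanh u, the integrand is k plus an odd function, and the odd part
  -- integrates to zero.
  have h : ∀ x : EuclideanSpace ℝ (Fin d), Real.exp (inner ℝ θ x) •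
      (k x / Real.cosh (inner ℝ θ x)) = k x + Real.tanh (inner ℝ θ x) * k x := by
    intro x
    have := (Real.cosh_pos (inner ℝ θ x)).ne'
    rw [Real.tanh_eq_sinh_div_cosh, ← Real.cosh_add_sinh, smul_eq_mul]
    field_simp
  simp_rw [h]
  have hi : Integrable (fun x => Real.tanh (inner ℝ θ x) * k x)
      (stdGaussian (EuclideanSpace ℝ (Fin d))) :=
    hint.bdd_mul (c := 1) (continuous_tanh.comp (by fun_prop)).aestronglyMeasurable
      (ae_of_all _ fun x => (Real.abs_tanh_lt_one _).le)
  rw [integral_add hint hi]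
  have h0 := integral_neg_stdGaussian fun x => Real.tanh (inner ℝ θ x) * k x
  simp only [inner_neg_right, Real.tanh_neg, hk, neg_mul, integral_neg] at h0
  linarith

/-- An odd function has the same mean under `N(θ, I)` as its product with `tanh (θᵀ x)`. -/
theorem integral_tanh_smul_of_odd {F : Type*} [NormedAddCommGroup F] [NormedSpace ℝ F]
    (θ : EuclideanSpace ℝ (Fin d)) {h : EuclideanSpace ℝ (Fin d) → F} (hodd : ∀ x, h (-x) = -h x)
    (hint : Integrable h (multivariateGaussian θ 1)) :
    ∫ x, Real.tanh (inner ℝ θ x) • h x ∂(multivariateGaussian θ 1) =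
      ∫ x, h x ∂(multivariateGaussian θ 1) := by
  have hi : Integrable (fun x => Real.tanh (inner ℝ θ x) • h x) (multivariateGaussian θ 1) :=
    hint.bdd_smul 1 (continuous_tanh.comp (by fun_prop)).aestronglyMeasurable
      (ae_of_all _ fun x => (Real.abs_tanh_lt_one _).le)
  rw [eq_comm, ← sub_eq_zero, ← integral_sub hint hi, integral_multivariateGaussian_one]
  refine smul_eq_zero_of_right _ ?_
  have h0 := integral_neg_stdGaussian fun x => Real.exp (inner ℝ θ x) •
    (h x - Real.tanh (inner ℝ θ x) • h x)
  have h1 : ∀ x : EuclideanSpace ℝ (Fin d), Real.exp (inner ℝ θ (-x)) •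
      (h (-x) - Real.tanh (inner ℝ θ (-x)) • h (-x)) =
      -(Real.exp (inner ℝ θ x) • (h x - Real.tanh (inner ℝ θ x) • h x)) := by
    intro x
    have h2 := (Real.cosh_pos (inner ℝ θ x)).ne'
    -- Both sides equal 1 / cosh(θᵀx), so the weight exp(θᵀx)(1 - tanh(θᵀx)) is even and its product
    -- with h is odd.
    have h3 : Real.exp (-inner ℝ θ x) * (1 + Real.tanh (inner ℝ θ x)) =
        Real.exp (inner ℝ θ x) * (1 - Real.tanh (inner ℝ θ x)) := by
      rw [Real.tanh_eq_sinh_div_cosh, ← Real.cosh_sub_sinh, ← Real.cosh_add_sinh]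
      field_simp
    have h4 : ∀ (e t : ℝ) (v : F), e • (v - t • v) = (e * (1 - t)) • v := by
      intro e t v; rw [mul_smul, sub_smul, one_smul]
    rw [hodd, inner_neg_right, Real.tanh_neg, h4, h4, smul_neg, sub_neg_eq_add, h3]
  simp_rw [h1, integral_neg] at h0
  refine (smul_eq_zero.1 ?_).resolve_left (two_ne_zero (α := ℝ))
  rw [two_smul]
  nth_rw 1 [← h0]
  exact neg_add_cancel _

/-! ### Moments and support of `N(θ, I)` -/

/-- Full support upgrades almost-everywhere equality of continuous functions to equality at every
point, which can then be tested at chosen points. -/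
instance isOpenPosMeasure_multivariateGaussian_one (θ : EuclideanSpace ℝ (Fin d)) :
    (multivariateGaussian θ (1 : Matrix (Fin d) (Fin d) ℝ)).IsOpenPosMeasure := by
  have h1 : (gaussianReal 0 1).IsOpenPosMeasure :=
    (gaussianReal_absolutelyContinuous' 0 one_ne_zero).isOpenPosMeasure
  have h2 : (stdGaussian (EuclideanSpace ℝ (Fin d))).IsOpenPosMeasure := by
    rw [← map_pi_eq_stdGaussian]
    exact (PiLp.continuous_toLp 2 _).isOpenPosMeasure_map (WithLp.toLp_surjective 2)
  rw [multivariateGaussian_one_eq_tilted]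
  exact (absolutelyContinuous_tilted (integrable_exp_inner_stdGaussian θ)).isOpenPosMeasure

theorem integrable_norm_pow_multivariateGaussian (θ : EuclideanSpace ℝ (Fin d)) (p : ℕ) :
    Integrable (fun x => ‖x‖ ^ p)
      (multivariateGaussian θ (1 : Matrix (Fin d) (Fin d) ℝ)) :=
  (IsGaussian.memLp_id (multivariateGaussian θ 1) p (by simp)).integrable_norm_pow'

theorem integrable_id_multivariateGaussian (θ : EuclideanSpace ℝ (Fin d)) :
    Integrable (fun x => x) (multivariateGaussian θ (1 : Matrix (Fin d) (Fin d) ℝ)) :=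
  IsGaussian.integrable_fun_id

theorem integral_inner_multivariateGaussian (θ v : EuclideanSpace ℝ (Fin d)) :
    ∫ x, inner ℝ v x ∂(multivariateGaussian θ 1) = inner ℝ v θ := by
  rw [integral_inner (integrable_id_multivariateGaussian θ), integral_id_multivariateGaussian]

theorem integral_inner_sq_multivariateGaussian (θ v : EuclideanSpace ℝ (Fin d)) :
    ∫ x, (inner ℝ v x) ^ 2 ∂(multivariateGaussian θ 1) = ‖v‖ ^ 2 + (inner ℝ v θ) ^ 2 := by
  have h2 : MemLp (fun x => inner ℝ v x) 2
      (multivariateGaussian θ (1 : Matrix (Fin d) (Fin d) ℝ)) :=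
    (IsGaussian.memLp_two_id (μ := multivariateGaussian θ 1)).const_inner v
  have h := covarianceBilin_multivariateGaussian (μ := θ)
    (Matrix.PosSemidef.one (n := Fin d) (R := ℝ)) v v
  rw [covarianceBilin_apply_eq_cov IsGaussian.memLp_two_id, covariance_eq_sub h2 h2,
    integral_inner_multivariateGaussian, Matrix.one_mulVec] at h
  have h3 : ‖v‖ ^ 2 = v.ofLp ⬝ᵥ v.ofLp := by
    rw [EuclideanSpace.real_norm_sq_eq]; simp [dotProduct, sq]
  rw [h3, ← h]
  simp [sq]

/-! ### Identifiability -/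

theorem log_cosh_nonneg (u : ℝ) : 0 ≤ Real.log (Real.cosh u) :=
  Real.log_nonneg (Real.one_le_cosh u)

theorem log_cosh_le_abs (u : ℝ) : Real.log (Real.cosh u) ≤ |u| := by
  rw [← Real.cosh_abs, Real.log_le_iff_le_exp (Real.cosh_pos _), ← Real.cosh_add_sinh]
  exact le_add_of_nonneg_right (Real.sinh_nonneg_iff.2 (abs_nonneg u))

theorem log_cosh_inner_le (θ x : EuclideanSpace ℝ (Fin d)) :
    Real.log (Real.cosh (inner ℝ θ x)) ≤ ‖θ‖ * ‖x‖ :=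
  (log_cosh_le_abs _).trans (abs_real_inner_le_norm _ _)

theorem continuous_log_cosh : Continuous fun u : ℝ => Real.log (Real.cosh u) :=
  Real.continuous_cosh.log fun u => (Real.cosh_pos u).ne'

theorem integrable_log_cosh_inner (θ₀ θ : EuclideanSpace ℝ (Fin d)) :
    Integrable (fun x => Real.log (Real.cosh (inner ℝ θ x))) (multivariateGaussian θ₀ 1) := by
  refine ((integrable_norm_pow_multivariateGaussian θ₀ 1).const_mul ‖θ‖).mono'
    (continuous_log_cosh.comp (by fun_prop)).aestronglyMeasurable (ae_of_all _ fun x => ?_)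
  rw [Real.norm_of_nonneg (log_cosh_nonneg _), pow_one]
  exact log_cosh_inner_le θ x

/-- The population version of the criterion. -/
noncomputable def populationCriterion (θ₀ θ : EuclideanSpace ℝ (Fin d)) : ℝ :=
  inner ℝ θ θ / 2 - ∫ x, Real.log (Real.cosh (inner ℝ θ x)) ∂(multivariateGaussian θ₀ 1)

/-- The ratio of the densities of the symmetric two-component mixtures at `θ` and `θ₀`. -/
noncomputable def densityRatio (θ₀ θ x : EuclideanSpace ℝ (Fin d)) : ℝ :=
  Real.exp (‖θ₀‖ ^ 2 / 2 - ‖θ‖ ^ 2 / 2) * (Real.cosh (inner ℝ θ x) / Real.cosh (inner ℝ θ₀ x))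

theorem densityRatio_pos (θ₀ θ x : EuclideanSpace ℝ (Fin d)) : 0 < densityRatio θ₀ θ x :=
  mul_pos (Real.exp_pos _) (div_pos (Real.cosh_pos _) (Real.cosh_pos _))

theorem continuous_densityRatio (θ₀ θ : EuclideanSpace ℝ (Fin d)) :
    Continuous (densityRatio θ₀ θ) :=
  continuous_const.mul ((Real.continuous_cosh.comp (by fun_prop)).div
    (Real.continuous_cosh.comp (by fun_prop)) fun x => (Real.cosh_pos _).ne')

theorem integrable_cosh_inner_stdGaussian (θ : EuclideanSpace ℝ (Fin d)) :
    Integrable (fun x => Real.cosh (inner ℝ θ x)) (stdGaussian (EuclideanSpace ℝ (Fin d))) := by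
  simp_rw [Real.cosh_eq, ← inner_neg_left]
  exact ((integrable_exp_inner_stdGaussian θ).add
    (integrable_exp_inner_stdGaussian (-θ))).div_const 2

theorem integral_cosh_inner_stdGaussian (θ : EuclideanSpace ℝ (Fin d)) :
    ∫ x, Real.cosh (inner ℝ θ x) ∂(stdGaussian (EuclideanSpace ℝ (Fin d))) =
      Real.exp (‖θ‖ ^ 2 / 2) := by
  simp_rw [Real.cosh_eq, ← inner_neg_left]
  rw [integral_div, integral_add (integrable_exp_inner_stdGaussian θ)
    (integrable_exp_inner_stdGaussian (-θ)), integral_exp_inner_stdGaussian,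
    integral_exp_inner_stdGaussian, norm_neg]
  ring

/-- The ratio compares mixture densities, but it is even, so its mean under the single component
N(θ₀, I) equals its mean under the mixture. -/
theorem integral_densityRatio (θ₀ θ : EuclideanSpace ℝ (Fin d)) :
    ∫ x, densityRatio θ₀ θ x ∂(multivariateGaussian θ₀ 1) = 1 := by
  unfold densityRatio
  rw [integral_const_mul, integral_div_cosh_multivariateGaussian θ₀
    (fun x => by rw [inner_neg_right, Real.cosh_neg]) (integrable_cosh_inner_stdGaussian θ),
    integral_cosh_inner_stdGaussian, ← Real.exp_add, ← Real.exp_add, ← Real.exp_zero]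
  congr 1
  ring

theorem integrable_densityRatio (θ₀ θ : EuclideanSpace ℝ (Fin d)) :
    Integrable (densityRatio θ₀ θ) (multivariateGaussian θ₀ 1) := by
  by_contra h
  have := integral_densityRatio θ₀ θ
  rw [integral_undef h] at this
  exact zero_ne_one this

theorem log_densityRatio (θ₀ θ x : EuclideanSpace ℝ (Fin d)) :
    Real.log (densityRatio θ₀ θ x) = (‖θ₀‖ ^ 2 / 2 - ‖θ‖ ^ 2 / 2) +
      (Real.log (Real.cosh (inner ℝ θ x)) - Real.log (Real.cosh (inner ℝ θ₀ x))) := by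
  have h1 := (Real.cosh_pos (inner ℝ θ x)).ne'
  have h2 := (Real.cosh_pos (inner ℝ θ₀ x)).ne'
  rw [densityRatio, Real.log_mul (Real.exp_pos _).ne' (div_ne_zero h1 h2), Real.log_exp,
    Real.log_div h1 h2]

/-- This is the equality case of Cauchy–Schwarz for vectors of equal norm. -/
theorem eq_or_eq_neg_of_abs_inner_eq {θ₀ θ : EuclideanSpace ℝ (Fin d)} (hn : ‖θ‖ = ‖θ₀‖)
    (h : |inner ℝ θ θ| = |inner ℝ θ₀ θ|) : θ = θ₀ ∨ θ = -θ₀ := by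
  rw [real_inner_self_eq_norm_sq, abs_of_nonneg (sq_nonneg _)] at h
  have h1 := norm_sub_sq_real θ₀ θ
  have h2 := norm_add_sq_real θ₀ θ
  rcases abs_cases (inner ℝ θ₀ θ) with ⟨h3, -⟩ | ⟨h3, -⟩
  · left
    have : ‖θ₀ - θ‖ ^ 2 = 0 := by rw [h1, ← h3, ← h, hn]; ring
    exact (sub_eq_zero.1 (norm_eq_zero.1 (pow_eq_zero_iff two_ne_zero |>.1 this))).symm
  · right
    have h4 : inner ℝ θ₀ θ = -‖θ‖ ^ 2 := by rw [h, h3, neg_neg]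
    have : ‖θ₀ + θ‖ ^ 2 = 0 := by rw [h2, h4, hn]; ring
    exact eq_neg_of_add_eq_zero_right (norm_eq_zero.1 (pow_eq_zero_iff two_ne_zero |>.1 this))

/-- With r the density ratio, which has mean 1, the difference of the two sides is the integral of r
- 1 - log r ≥ 0. If it vanished, r would be 1 everywhere by continuity and full support; r(0) = 1
gives equal norms and r(θ) = 1 gives |θᵀθ| = |θ₀ᵀθ|, hence θ = ±θ₀. -/
theorem populationCriterion_lt {θ₀ θ : EuclideanSpace ℝ (Fin d)} (h1 : θ ≠ θ₀) (h2 : θ ≠ -θ₀) :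
    populationCriterion θ₀ θ₀ < populationCriterion θ₀ θ := by
  set γ := multivariateGaussian θ₀ (1 : Matrix (Fin d) (Fin d) ℝ) with hγ
  let f : EuclideanSpace ℝ (Fin d) → ℝ := fun x =>
    densityRatio θ₀ θ x - 1 - Real.log (densityRatio θ₀ θ x)
  have hL := integrable_log_cosh_inner θ₀ θ
  have hL₀ := integrable_log_cosh_inner θ₀ θ₀
  have hlog : Integrable (fun x => Real.log (densityRatio θ₀ θ x)) γ := by
    simp_rw [log_densityRatio]
    exact (integrable_const _).add (hL.sub hL₀)
  have hd1 := (integrable_densityRatio θ₀ θ).sub (integrable_const (1 : ℝ))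
  have hf0 : ∀ x, 0 ≤ f x := fun x => by
    have := Real.log_le_sub_one_of_pos (densityRatio_pos θ₀ θ x)
    simp only [f]
    linarith
  have hfi : Integrable f γ := hd1.sub hlog
  have hint : ∫ x, f x ∂γ = populationCriterion θ₀ θ - populationCriterion θ₀ θ₀ := by
    have e1 : ∫ x, f x ∂γ = ∫ x, (densityRatio θ₀ θ x - 1) ∂γ -
        ∫ x, Real.log (densityRatio θ₀ θ x) ∂γ := integral_sub hd1 hlog
    have e2 : ∫ x, (densityRatio θ₀ θ x - 1) ∂γ = 0 := by
      rw [integral_sub (integrable_densityRatio θ₀ θ) (integrable_const _),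
        integral_densityRatio]
      simp
    rw [e1, e2]
    simp_rw [log_densityRatio]
    have hd : Integrable (fun x => Real.log (Real.cosh (inner ℝ θ x)) -
        Real.log (Real.cosh (inner ℝ θ₀ x))) γ := hL.sub hL₀
    rw [integral_add (integrable_const _) hd, integral_sub hL hL₀]
    simp only [populationCriterion, real_inner_self_eq_norm_sq, integral_const, probReal_univ,
      one_smul]
    ring
  rw [← sub_pos, ← hint]
  refine lt_of_le_of_ne (integral_nonneg hf0) fun h0 => ?_
  have hae := (integral_eq_zero_iff_of_nonneg hf0 hfi).1 h0.symm
  have hfc : Continuous f := ((continuous_densityRatio θ₀ θ).sub continuous_const).sub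
    ((continuous_densityRatio θ₀ θ).log fun x => (densityRatio_pos θ₀ θ x).ne')
  have hfz : f = 0 := (Continuous.ae_eq_iff_eq γ hfc continuous_zero).1 hae
  have hr : ∀ x, densityRatio θ₀ θ x = 1 := fun x => by
    by_contra hne
    have h3 := Real.log_lt_sub_one_of_pos (densityRatio_pos θ₀ θ x) hne
    have h4 : f x = 0 := congrFun hfz x
    simp only [f] at h4
    linarith
  have hz := log_densityRatio θ₀ θ 0
  simp only [hr, inner_zero_right, Real.log_one, sub_self, add_zero] at hz
  have hnorm : ‖θ‖ = ‖θ₀‖ :=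
    (pow_left_inj₀ (norm_nonneg _) (norm_nonneg _) two_ne_zero).1 (by linarith)
  have hc := log_densityRatio θ₀ θ θ
  rw [hr, Real.log_one, hnorm] at hc
  have hc2 : Real.log (Real.cosh (inner ℝ θ θ)) = Real.log (Real.cosh (inner ℝ θ₀ θ)) := by
    linarith
  have hc3 := Real.log_injOn_pos (Real.cosh_pos _) (Real.cosh_pos _) hc2
  have hc4 : |inner ℝ θ θ| = |inner ℝ θ₀ θ| :=
    le_antisymm (Real.cosh_le_cosh.1 hc3.le) (Real.cosh_le_cosh.1 hc3.ge)
  exact (eq_or_eq_neg_of_abs_inner_eq hnorm hc4).elim h1 h2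

/-! ### The score and the information matrix -/

/-- The score `X tanh(θᵀ X) - θ`. -/
noncomputable def score (θ x : EuclideanSpace ℝ (Fin d)) : EuclideanSpace ℝ (Fin d) :=
  Real.tanh (inner ℝ θ x) • x - θ

/-- The operator `X Xᵀ sech²(θᵀ X)`. -/
noncomputable def curvature (θ x : EuclideanSpace ℝ (Fin d)) :
    EuclideanSpace ℝ (Fin d) →L[ℝ] EuclideanSpace ℝ (Fin d) :=
  (1 / Real.cosh (inner ℝ θ x)) ^ 2 • (innerSL ℝ x).smulRight x

theorem curvature_apply (θ x v : EuclideanSpace ℝ (Fin d)) :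
    curvature θ x v = ((1 / Real.cosh (inner ℝ θ x)) ^ 2 * inner ℝ x v) • x := by
  simp [curvature, smul_smul]

theorem inner_curvature (θ x v w : EuclideanSpace ℝ (Fin d)) :
    inner ℝ v (curvature θ x w) =
      inner ℝ v x * inner ℝ w x * (1 / Real.cosh (inner ℝ θ x)) ^ 2 := by
  rw [curvature_apply, inner_smul_right, real_inner_comm x w]
  ring

theorem norm_tanh_smul_le (θ x : EuclideanSpace ℝ (Fin d)) :
    ‖Real.tanh (inner ℝ θ x) • x‖ ≤ ‖x‖ := by
  rw [norm_smul]
  exact mul_le_of_le_one_left (norm_nonneg _) (Real.abs_tanh_lt_one _).le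

theorem sech_sq_le_one (u : ℝ) : (1 / Real.cosh u) ^ 2 ≤ 1 := by
  refine pow_le_one₀ (by positivity) ?_
  rw [div_le_one (Real.cosh_pos u)]
  exact Real.one_le_cosh u

theorem norm_curvature_le (θ x : EuclideanSpace ℝ (Fin d)) : ‖curvature θ x‖ ≤ ‖x‖ ^ 2 := by
  rw [curvature, norm_smul, Real.norm_of_nonneg (by positivity),
    ContinuousLinearMap.norm_smulRight_apply, innerSL_apply_norm, sq ‖x‖]
  exact mul_le_of_le_one_left (by positivity) (sech_sq_le_one _)

theorem continuous_curvature :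
    Continuous fun p : EuclideanSpace ℝ (Fin d) × EuclideanSpace ℝ (Fin d) =>
      curvature p.1 p.2 := by
  unfold curvature
  refine ((continuous_const.div (Real.continuous_cosh.comp (by fun_prop))
    fun p => (Real.cosh_pos _).ne').pow 2).smul ?_
  exact ((ContinuousLinearMap.smulRightL ℝ (EuclideanSpace ℝ (Fin d))
    (EuclideanSpace ℝ (Fin d))).continuous₂).comp
    (((innerSL ℝ).continuous.comp continuous_snd).prodMk continuous_snd)

theorem continuous_score (θ : EuclideanSpace ℝ (Fin d)) : Continuous (score θ) :=
  ((continuous_tanh.comp (by fun_prop)).smul continuous_id).sub continuous_const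

theorem integrable_curvature (θ₀ θ : EuclideanSpace ℝ (Fin d)) :
    Integrable (curvature θ) (multivariateGaussian θ₀ 1) :=
  (integrable_norm_pow_multivariateGaussian θ₀ 2).mono'
    (continuous_curvature.comp (by fun_prop : Continuous fun x => (θ, x))).aestronglyMeasurable
    (ae_of_all _ fun x => norm_curvature_le θ x)

theorem inner_integral_curvature (θ₀ θ v w : EuclideanSpace ℝ (Fin d)) :
    inner ℝ v ((∫ x, curvature θ x ∂(multivariateGaussian θ₀ 1)) w) =
      ∫ x, inner ℝ v x * inner ℝ w x * (1 / Real.cosh (inner ℝ θ x)) ^ 2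
        ∂(multivariateGaussian θ₀ 1) := by
  have hi := integrable_curvature θ₀ θ
  rw [ContinuousLinearMap.integral_apply hi, ← integral_inner (hi.apply_continuousLinearMap w)]
  simp_rw [inner_curvature]

theorem toEuclideanCLM_info (θ : EuclideanSpace ℝ (Fin d)) :
    Matrix.toEuclideanCLM (𝕜 := ℝ) (info θ) =
      ContinuousLinearMap.id ℝ _ - ∫ x, curvature θ x ∂(multivariateGaussian θ 1) := by
  refine ContinuousLinearMap.coe_injective
    ((EuclideanSpace.basisFun (Fin d) ℝ).toBasis.ext fun k => ?_)
  ext j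
  have h := inner_integral_curvature θ θ (EuclideanSpace.basisFun (Fin d) ℝ j)
    (EuclideanSpace.basisFun (Fin d) ℝ k)
  simp only [EuclideanSpace.basisFun_apply, EuclideanSpace.inner_single_left, map_one,
    one_mul] at h
  simp [info, Matrix.ofLp_toEuclideanCLM, h]

theorem inner_info (θ v w : EuclideanSpace ℝ (Fin d)) :
    inner ℝ v (Matrix.toEuclideanCLM (𝕜 := ℝ) (info θ) w) = inner ℝ v w -
      ∫ x, inner ℝ v x * inner ℝ w x * (1 / Real.cosh (inner ℝ θ x)) ^ 2
        ∂(multivariateGaussian θ 1) := by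
  rw [toEuclideanCLM_info, sub_apply, inner_sub_right,
    inner_integral_curvature]
  rfl

theorem norm_score_le (θ x : EuclideanSpace ℝ (Fin d)) : ‖score θ x‖ ≤ ‖x‖ + ‖θ‖ :=
  (norm_sub_le _ _).trans (add_le_add (norm_tanh_smul_le θ x) le_rfl)

theorem memLp_inner_score (θ v : EuclideanSpace ℝ (Fin d)) :
    MemLp (fun x => inner ℝ v (score θ x)) 2 (multivariateGaussian θ 1) := by
  have h : MemLp (score θ) 2 (multivariateGaussian θ 1) := by
    have h1 : MemLp (fun x : EuclideanSpace ℝ (Fin d) => ‖x‖ + ‖θ‖) 2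
        (multivariateGaussian θ 1) :=
      (IsGaussian.memLp_two_id (μ := multivariateGaussian θ 1)).norm.add (memLp_const _)
    refine h1.mono (continuous_score θ).aestronglyMeasurable (ae_of_all _ fun x => ?_)
    exact (norm_score_le θ x).trans (le_abs_self _)
  exact h.const_inner v

theorem integral_inner_tanh (θ v : EuclideanSpace ℝ (Fin d)) :
    ∫ x, Real.tanh (inner ℝ θ x) * inner ℝ v x ∂(multivariateGaussian θ 1) = inner ℝ v θ := by
  have h := integral_tanh_smul_of_odd θ (h := fun x => inner ℝ v x)
    (fun x => inner_neg_right _ _) ((integrable_id_multivariateGaussian θ).const_inner v)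
  simpa only [smul_eq_mul, integral_inner_multivariateGaussian] using h

theorem integral_inner_score (θ v : EuclideanSpace ℝ (Fin d)) :
    ∫ x, inner ℝ v (score θ x) ∂(multivariateGaussian θ 1) = 0 := by
  have hb : Integrable (fun x => Real.tanh (inner ℝ θ x) * inner ℝ v x)
      (multivariateGaussian θ 1) :=
    ((integrable_id_multivariateGaussian θ).const_inner v).bdd_mul (c := 1)
      (continuous_tanh.comp (by fun_prop)).aestronglyMeasurable
      (ae_of_all _ fun x => (Real.abs_tanh_lt_one _).le)
  simp_rw [score, inner_sub_right, inner_smul_right]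
  rw [integral_sub hb (integrable_const _), integral_inner_tanh]
  simp

/-- The information identity: sech² = 1 - tanh² turns the second moment of the score into the
expected Hessian. -/
theorem integral_inner_score_sq (θ v : EuclideanSpace ℝ (Fin d)) :
    ∫ x, (inner ℝ v (score θ x)) ^ 2 ∂(multivariateGaussian θ 1) =
      inner ℝ v (Matrix.toEuclideanCLM (𝕜 := ℝ) (info θ) v) := by
  set γ := multivariateGaussian θ (1 : Matrix (Fin d) (Fin d) ℝ) with hγ
  have hb : Integrable (fun x => Real.tanh (inner ℝ θ x) * inner ℝ v x) γ :=
    ((integrable_id_multivariateGaussian θ).const_inner v).bdd_mul (c := 1)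
      (continuous_tanh.comp (by fun_prop)).aestronglyMeasurable
      (ae_of_all _ fun x => (Real.abs_tanh_lt_one _).le)
  have hsq : Integrable (fun x => (inner ℝ v x) ^ 2) γ :=
    ((IsGaussian.memLp_two_id (μ := γ)).const_inner v).integrable_sq
  have hsech : Integrable (fun x => inner ℝ v x * inner ℝ v x *
      (1 / Real.cosh (inner ℝ θ x)) ^ 2) γ := by
    simp_rw [← inner_curvature]
    exact ((integrable_curvature θ θ).apply_continuousLinearMap v).const_inner v
  have hpt : ∀ x, (inner ℝ v (score θ x)) ^ 2 =
      ((inner ℝ v x) ^ 2 - inner ℝ v x * inner ℝ v x * (1 / Real.cosh (inner ℝ θ x)) ^ 2) -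
      (2 * inner ℝ v θ * (Real.tanh (inner ℝ θ x) * inner ℝ v x) - (inner ℝ v θ) ^ 2) := by
    intro x
    have h1 : (1 / Real.cosh (inner ℝ θ x)) ^ 2 = 1 - Real.tanh (inner ℝ θ x) ^ 2 := by
      have := (Real.cosh_pos (inner ℝ θ x)).ne'
      rw [Real.tanh_eq_sinh_div_cosh, div_pow, div_pow, Real.sinh_sq]
      field_simp
      ring
    rw [score, inner_sub_right, inner_smul_right, h1]
    ring
  simp_rw [hpt]
  have hi1 : Integrable (fun x => (inner ℝ v x) ^ 2 -
      inner ℝ v x * inner ℝ v x * (1 / Real.cosh (inner ℝ θ x)) ^ 2) γ := hsq.sub hsech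
  have hi2 : Integrable (fun x => 2 * inner ℝ v θ * (Real.tanh (inner ℝ θ x) * inner ℝ v x) -
      (inner ℝ v θ) ^ 2) γ := (hb.const_mul _).sub (integrable_const _)
  rw [integral_sub hi1 hi2,
    integral_sub hsq hsech, integral_sub (hb.const_mul _) (integrable_const _),
    integral_const_mul, integral_inner_tanh, integral_inner_sq_multivariateGaussian,
    inner_info, real_inner_self_eq_norm_sq]
  simp only [integral_const, probReal_univ, one_smul]
  ring

theorem isHermitian_info (θ : EuclideanSpace ℝ (Fin d)) : (info θ).IsHermitian := by
  ext j k
  simp only [info, Matrix.conjTranspose_apply, Matrix.sub_apply, Matrix.of_apply, star_trivial,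
    Matrix.one_apply, eq_comm (a := k)]
  simp_rw [mul_comm (_ : ℝ) ((_ : EuclideanSpace ℝ (Fin d)) j)]

theorem inner_info_pos {θ : EuclideanSpace ℝ (Fin d)} (hθ : θ ≠ 0)
    {v : EuclideanSpace ℝ (Fin d)} (hv : v ≠ 0) :
    0 < inner ℝ v (Matrix.toEuclideanCLM (𝕜 := ℝ) (info θ) v) := by
  rw [← integral_inner_score_sq]
  refine lt_of_le_of_ne (integral_nonneg fun x => sq_nonneg _) fun h0 => hv ?_
  have hae := (integral_eq_zero_iff_of_nonneg (fun x => sq_nonneg _)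
    (memLp_inner_score θ v).integrable_sq).1 h0.symm
  have hc : Continuous fun x => (inner ℝ v (score θ x)) ^ 2 :=
    (continuous_const.inner (continuous_score θ)).pow 2
  have hz := (Continuous.ae_eq_iff_eq _ hc continuous_zero).1 hae
  have hs : ∀ x, inner ℝ v (score θ x) = 0 := fun x =>
    pow_eq_zero_iff two_ne_zero |>.1 (congrFun hz x)
  have h1 : inner ℝ v θ = 0 := by simpa [score] using hs 0
  have h2 : inner ℝ θ v = 0 := by rwa [real_inner_comm]
  -- The value at 0 gave v ⊥ θ, so at x = v + θ the identity reads tanh(‖θ‖²) ‖v‖² = 0.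
  have h3 := hs (v + θ)
  rw [score, inner_sub_right, inner_smul_right, inner_add_right, inner_add_right, h1, h2,
    zero_add, add_zero, sub_zero, real_inner_self_eq_norm_sq, real_inner_self_eq_norm_sq] at h3
  have h4 : Real.tanh (‖θ‖ ^ 2) ≠ 0 := by
    rw [Real.tanh_eq_sinh_div_cosh]
    refine div_ne_zero ?_ (Real.cosh_pos _).ne'
    rw [Real.sinh_ne_zero]
    exact pow_ne_zero 2 (norm_ne_zero_iff.2 hθ)
  simpa using (mul_eq_zero.1 h3).resolve_left h4

theorem posDef_info {θ : EuclideanSpace ℝ (Fin d)} (hθ : θ ≠ 0) : (info θ).PosDef := by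
  refine Matrix.PosDef.of_dotProduct_mulVec_pos (isHermitian_info θ) fun v hv => ?_
  have h := inner_info_pos hθ (v := WithLp.toLp 2 v) (by simpa using hv)
  rw [Matrix.inner_toEuclideanCLM] at h
  simpa using h

/-! ### The criterion and its derivatives -/

/-- The gradient of the criterion. -/
noncomputable def criterionGrad (x : Fin n → EuclideanSpace ℝ (Fin d))
    (θ : EuclideanSpace ℝ (Fin d)) : EuclideanSpace ℝ (Fin d) :=
  θ - (1 / (n : ℝ)) • ∑ i, Real.tanh (inner ℝ θ (x i)) • x i

theorem hasFDerivAt_inner_left (y θ : EuclideanSpace ℝ (Fin d)) :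
    HasFDerivAt (fun θ : EuclideanSpace ℝ (Fin d) => inner ℝ θ y) (innerSL ℝ y) θ := by
  refine ((innerSL ℝ y).hasFDerivAt (x := θ)).congr_of_eventuallyEq
    (Eventually.of_forall fun z => ?_)
  simp [real_inner_comm]

theorem hasFDerivAt_criterion (x : Fin n → EuclideanSpace ℝ (Fin d))
    (θ : EuclideanSpace ℝ (Fin d)) :
    HasFDerivAt (criterion x) (innerSL ℝ (criterionGrad x θ)) θ := by
  have hlog : ∀ u : ℝ, HasDerivAt (fun u => Real.log (Real.cosh u)) (Real.tanh u) u := by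
    intro u
    rw [Real.tanh_eq_sinh_div_cosh]
    exact (Real.hasDerivAt_cosh u).log (Real.cosh_pos u).ne'
  have hsum := HasFDerivAt.fun_sum (u := Finset.univ) fun i _ =>
    (hlog (inner ℝ θ (x i))).comp_hasFDerivAt θ (hasFDerivAt_inner_left (x i) θ)
  have hself := ((hasFDerivAt_id θ).inner ℝ (hasFDerivAt_id θ)).mul_const (1 / 2 : ℝ)
  have h := hself.sub (hsum.const_mul (1 / (n : ℝ)))
  refine (h.congr_of_eventuallyEq (Eventually.of_forall fun z => ?_)).congr_fderiv ?_
  · simp [criterion, div_eq_mul_inv]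
  · ext v
    simp [criterionGrad, real_inner_comm]
    ring

theorem continuous_criterion (x : Fin n → EuclideanSpace ℝ (Fin d)) :
    Continuous (criterion x) :=
  continuous_iff_continuousAt.2 fun θ => (hasFDerivAt_criterion x θ).continuousAt

theorem criterionGrad_eq_zero {x : Fin n → EuclideanSpace ℝ (Fin d)}
    {θ : EuclideanSpace ℝ (Fin d)} (h : ∀ θ', criterion x θ ≤ criterion x θ') :
    criterionGrad x θ = 0 := by
  have h0 := IsLocalMin.hasFDerivAt_eq_zero (Eventually.of_forall h)
    (hasFDerivAt_criterion x θ)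
  have h1 := congrArg (fun L => L (criterionGrad x θ)) h0
  simpa using h1

theorem hasFDerivAt_criterionGrad (x : Fin n → EuclideanSpace ℝ (Fin d))
    (θ : EuclideanSpace ℝ (Fin d)) :
    HasFDerivAt (criterionGrad x)
      (ContinuousLinearMap.id ℝ _ - (1 / (n : ℝ)) • ∑ i, curvature θ (x i)) θ := by
  have hsum := HasFDerivAt.fun_sum (u := Finset.univ) fun i _ =>
    ((hasDerivAt_tanh (inner ℝ θ (x i))).comp_hasFDerivAt θ (hasFDerivAt_inner_left (x i) θ)).smul_const (x i)
  have h := (hasFDerivAt_id θ).sub (hsum.const_smul (1 / (n : ℝ)))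
  refine (h.congr_of_eventuallyEq (Eventually.of_forall fun z => ?_)).congr_fderiv ?_
  · simp [criterionGrad]
  · ext1 v
    simp [curvature_apply]

/-- The mean value inequality: near θ₀ the gradient is affine with slope H up to relative error e.
Both uniqueness and the expansion rest on it. -/
theorem norm_criterionGrad_sub_le {x : Fin n → EuclideanSpace ℝ (Fin d)}
    {θ₀ : EuclideanSpace ℝ (Fin d)} {δ e : ℝ}
    {H : EuclideanSpace ℝ (Fin d) →L[ℝ] EuclideanSpace ℝ (Fin d)}
    (hH : ∀ θ ∈ Metric.ball θ₀ δ,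
      ‖(ContinuousLinearMap.id ℝ _ - (1 / (n : ℝ)) • ∑ i, curvature θ (x i)) - H‖ ≤ e)
    {θ θ' : EuclideanSpace ℝ (Fin d)} (hθ : θ ∈ Metric.ball θ₀ δ) (hθ' : θ' ∈ Metric.ball θ₀ δ) :
    ‖criterionGrad x θ' - criterionGrad x θ - H (θ' - θ)‖ ≤ e * ‖θ' - θ‖ :=
  Convex.norm_image_sub_le_of_norm_hasFDerivWithin_le'
    (fun z _ => (hasFDerivAt_criterionGrad x z).hasFDerivWithinAt) hH (convex_ball θ₀ δ) hθ hθ'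

/-! ### Coercivity, localisation and uniqueness of the minimiser. -/

theorem criterion_zero (x : Fin n → EuclideanSpace ℝ (Fin d)) : criterion x 0 = 0 := by
  simp [criterion]

theorem criterion_neg (x : Fin n → EuclideanSpace ℝ (Fin d)) (θ : EuclideanSpace ℝ (Fin d)) :
    criterion x (-θ) = criterion x θ := by
  simp [criterion]

/-- Since log cosh u ≤ |u|, the data term grows at most linearly and the quadratic term dominates.
-/
theorem le_criterion {x : Fin n → EuclideanSpace ℝ (Fin d)} {C : ℝ}
    (hC : (1 / (n : ℝ)) * ∑ i, ‖x i‖ ≤ C) (θ : EuclideanSpace ℝ (Fin d)) :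
    ‖θ‖ * (‖θ‖ / 2 - C) ≤ criterion x θ := by
  have h : (1 / (n : ℝ)) * ∑ i, Real.log (Real.cosh (inner ℝ θ (x i))) ≤ ‖θ‖ * C :=
    calc (1 / (n : ℝ)) * ∑ i, Real.log (Real.cosh (inner ℝ θ (x i)))
        ≤ (1 / (n : ℝ)) * ∑ i, ‖θ‖ * ‖x i‖ := by
          gcongr with i
          exact log_cosh_inner_le θ (x i)
      _ = ‖θ‖ * ((1 / (n : ℝ)) * ∑ i, ‖x i‖) := by rw [← Finset.mul_sum]; ring
      _ ≤ ‖θ‖ * C := by gcongr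
  rw [criterion, real_inner_self_eq_norm_sq]
  linarith

theorem criterion_pos_of_lt_norm {x : Fin n → EuclideanSpace ℝ (Fin d)} {C R : ℝ} (hR : 0 ≤ R)
    (hCR : 2 * C ≤ R) (hC : (1 / (n : ℝ)) * ∑ i, ‖x i‖ ≤ C) {θ : EuclideanSpace ℝ (Fin d)}
    (hθ : R < ‖θ‖) : 0 < criterion x θ :=
  lt_of_lt_of_le (mul_pos (hR.trans_lt hθ) (by linarith)) (le_criterion hC θ)

/-- The half-space need not be closed, so the minimum is first sought over the whole space; evenness
in θ later moves a minimiser into the half-space. Outside the ball the criterion exceeds its value 0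
at the origin. -/
theorem exists_forall_criterion_le {x : Fin n → EuclideanSpace ℝ (Fin d)} {C R : ℝ} (hR : 0 ≤ R)
    (hCR : 2 * C ≤ R) (hC : (1 / (n : ℝ)) * ∑ i, ‖x i‖ ≤ C) :
    ∃ θ, ∀ θ', criterion x θ ≤ criterion x θ' := by
  obtain ⟨θ, -, hmin⟩ := (isCompact_closedBall (0 : EuclideanSpace ℝ (Fin d)) R).exists_isMinOn
    ⟨0, by simpa using hR⟩ (continuous_criterion x).continuousOn
  refine ⟨θ, fun θ' => ?_⟩
  rcases le_or_gt ‖θ'‖ R with h | h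
  · exact hmin (by simpa using h)
  · have h0 : criterion x θ ≤ criterion x 0 := hmin (by simpa using hR)
    rw [criterion_zero] at h0
    exact h0.trans (criterion_pos_of_lt_norm hR hCR hC h).le

/-- Global minimisers of the criterion are close to `θ₀` or `-θ₀` when the criterion is uniformly
close to its population version. -/
theorem near_of_forall_criterion_le {x : Fin n → EuclideanSpace ℝ (Fin d)}
    {θ₀ : EuclideanSpace ℝ (Fin d)} {C R η δ : ℝ} (hR : 0 ≤ R) (hθ₀ : ‖θ₀‖ ≤ R)
    (hCR : 2 * C ≤ R) (hC : (1 / (n : ℝ)) * ∑ i, ‖x i‖ ≤ C)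
    (hη : ∀ θ : EuclideanSpace ℝ (Fin d), ‖θ‖ ≤ R →
      |criterion x θ - populationCriterion θ₀ θ| < η)
    (hsep : ∀ θ : EuclideanSpace ℝ (Fin d), ‖θ‖ ≤ R → δ ≤ ‖θ - θ₀‖ → δ ≤ ‖θ + θ₀‖ →
      populationCriterion θ₀ θ₀ + 2 * η ≤ populationCriterion θ₀ θ)
    {θ : EuclideanSpace ℝ (Fin d)} (hmin : ∀ θ', criterion x θ ≤ criterion x θ') :
    ‖θ - θ₀‖ < δ ∨ ‖θ + θ₀‖ < δ := by
  by_contra! h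
  have hθ : ‖θ‖ ≤ R := by
    by_contra! hlt
    have h1 := criterion_pos_of_lt_norm hR hCR hC hlt
    have h2 := hmin 0
    rw [criterion_zero] at h2
    linarith
  have h1 := hsep θ hθ h.1 h.2
  have h2 := abs_lt.1 (hη θ hθ)
  have h3 := abs_lt.1 (hη θ₀ hθ₀)
  have h4 := hmin θ₀
  linarith [h2.1, h3.2]

theorem neg_notMem_halfSpace {θ : EuclideanSpace ℝ (Fin d)} (h : θ ∈ halfSpace d) :
    -θ ∉ halfSpace d := by
  rintro ⟨k, hk, hk'⟩
  obtain ⟨j, hj, hj'⟩ := h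
  rcases lt_trichotomy j k with hlt | rfl | hlt
  · have := hk' j hlt
    simp only [PiLp.neg_apply, neg_eq_zero] at this
    exact hj.ne' this
  · simp only [PiLp.neg_apply] at hk
    linarith
  · have := hj' k hlt
    simp [this] at hk

/-- On the event where the criterion and its Hessian are uniformly close to their population
versions, the minimiser over the half-space is unique and solves the score equation near `θ₀`. -/
theorem exists_unique_isMinimiser {x : Fin n → EuclideanSpace ℝ (Fin d)}
    {θ₀ : EuclideanSpace ℝ (Fin d)} {C R η δ e c : ℝ} (hR : 0 ≤ R) (hθ₀ : ‖θ₀‖ ≤ R)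
    (hCR : 2 * C ≤ R) (hC : (1 / (n : ℝ)) * ∑ i, ‖x i‖ ≤ C)
    (hη : ∀ θ : EuclideanSpace ℝ (Fin d), ‖θ‖ ≤ R →
      |criterion x θ - populationCriterion θ₀ θ| < η)
    (hsep : ∀ θ : EuclideanSpace ℝ (Fin d), ‖θ‖ ≤ R → δ ≤ ‖θ - θ₀‖ → δ ≤ ‖θ + θ₀‖ →
      populationCriterion θ₀ θ₀ + 2 * η ≤ populationCriterion θ₀ θ)
    (hball : Metric.ball θ₀ δ ⊆ halfSpace d)
    {H : EuclideanSpace ℝ (Fin d) →L[ℝ] EuclideanSpace ℝ (Fin d)}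
    (hH : ∀ θ ∈ Metric.ball θ₀ δ,
      ‖(ContinuousLinearMap.id ℝ _ - (1 / (n : ℝ)) • ∑ i, curvature θ (x i)) - H‖ ≤ e)
    (hc : ∀ v, ‖v‖ ≤ c * ‖H v‖) (hc0 : 0 ≤ c) (hce : c * e < 1) :
    ∃ θ ∈ Metric.ball θ₀ δ, criterionGrad x θ = 0 ∧ ∀ θ', IsMinimiser x θ' ↔ θ' = θ := by
  have hnear : ∀ {θ}, (∀ θ', criterion x θ ≤ criterion x θ') →
      ‖θ - θ₀‖ < δ ∨ ‖θ + θ₀‖ < δ := near_of_forall_criterion_le hR hθ₀ hCR hC hη hsep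
  obtain ⟨θ, hθ, hmin⟩ : ∃ θ ∈ Metric.ball θ₀ δ, ∀ θ', criterion x θ ≤ criterion x θ' := by
    obtain ⟨θ, hmin⟩ := exists_forall_criterion_le hR hCR hC
    rcases hnear hmin with h | h
    · exact ⟨θ, by rwa [mem_ball_iff_norm], hmin⟩
    · refine ⟨-θ, ?_, fun θ' => (criterion_neg x θ).trans_le (hmin θ')⟩
      rwa [mem_ball_iff_norm, ← norm_neg, neg_sub, sub_neg_eq_add, add_comm]
  refine ⟨θ, hθ, criterionGrad_eq_zero hmin, fun θ' => ⟨fun h => ?_, ?_⟩⟩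
  -- The global minimiser θ lies in the half-space, so a minimiser over the half-space is a global
  -- one.
  · have hmin' : ∀ z, criterion x θ' ≤ criterion x z := fun z => (h.2 (hball hθ)).trans (hmin z)
    have hθ' : θ' ∈ Metric.ball θ₀ δ := by
      rcases hnear hmin' with h1 | h1
      · rwa [mem_ball_iff_norm]
      · refine absurd (hball ?_) (neg_notMem_halfSpace h.1)
        rwa [mem_ball_iff_norm, ← norm_neg, neg_sub, sub_neg_eq_add, add_comm]
    have h1 := norm_criterionGrad_sub_le hH hθ hθ'
    rw [criterionGrad_eq_zero hmin, criterionGrad_eq_zero hmin', sub_self, zero_sub,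
      norm_neg] at h1
    -- Both gradients vanish, so H(θ' - θ) is at most e‖θ' - θ‖; as c e < 1, the two points
    -- coincide.
    have h2 : ‖θ' - θ‖ ≤ c * e * ‖θ' - θ‖ := by
      refine (hc _).trans ?_
      rw [mul_assoc]
      exact mul_le_mul_of_nonneg_left h1 hc0
    have h3 : ‖θ' - θ‖ = 0 := by
      by_contra hne
      have hpos : 0 < ‖θ' - θ‖ := lt_of_le_of_ne (norm_nonneg _) (Ne.symm hne)
      nlinarith
    exact sub_eq_zero.1 (norm_eq_zero.1 h3)
  · rintro rfl
    exact ⟨hball hθ, fun z _ => hmin z⟩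

/-! ### Linearisation of the score equation. -/

theorem criterionGrad_eq_neg_score (hn : n ≠ 0) (x : Fin n → EuclideanSpace ℝ (Fin d))
    (θ : EuclideanSpace ℝ (Fin d)) :
    criterionGrad x θ = -((1 / (n : ℝ)) • ∑ i, score θ (x i)) := by
  have hn' : (n : ℝ) ≠ 0 := Nat.cast_ne_zero.2 hn
  simp only [criterionGrad, score, Finset.sum_sub_distrib, Finset.sum_const, Finset.card_univ,
    Fintype.card_fin, smul_sub, ← Nat.cast_smul_eq_nsmul ℝ, smul_smul]
  rw [one_div_mul_cancel hn', one_smul]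
  abel

theorem leadingTerm_eq (hn : n ≠ 0) (x : Fin n → EuclideanSpace ℝ (Fin d))
    (θ : EuclideanSpace ℝ (Fin d)) :
    leadingTerm θ x = √(n : ℝ) • Matrix.toEuclideanCLM (𝕜 := ℝ) (info θ)⁻¹
      (-criterionGrad x θ) := by
  have hn' : (0 : ℝ) < n := Nat.cast_pos.2 (Nat.pos_of_ne_zero hn)
  rw [criterionGrad_eq_neg_score hn, neg_neg, ← map_smul, smul_smul, leadingTerm]
  congr 2
  rw [mul_one_div, Real.sqrt_div_self, one_div]

/-- Applying the inverse of I₀ to the linearised score equation gives ‖h - s‖ ≤ c e ‖h‖ for h = θ -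
θ₀ and s the unscaled leading term. As c e ≤ 1/2, ‖h‖ ≤ 2‖s‖, so the error is relative to the
leading term and no prior rate for θ is needed. -/
theorem norm_expansion_le (hn : n ≠ 0) {x : Fin n → EuclideanSpace ℝ (Fin d)}
    {θ₀ θ : EuclideanSpace ℝ (Fin d)} {δ e c : ℝ} (hdet : IsUnit (info θ₀).det)
    (hH : ∀ θ ∈ Metric.ball θ₀ δ, ‖(ContinuousLinearMap.id ℝ _ -
      (1 / (n : ℝ)) • ∑ i, curvature θ (x i)) - Matrix.toEuclideanCLM (𝕜 := ℝ) (info θ₀)‖ ≤ e)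
    (hc : ‖Matrix.toEuclideanCLM (𝕜 := ℝ) (info θ₀)⁻¹‖ ≤ c) (hce : c * e ≤ 1 / 2)
    (hθ : θ ∈ Metric.ball θ₀ δ) (hgrad : criterionGrad x θ = 0) :
    ‖√(n : ℝ) • (θ - θ₀) - leadingTerm θ₀ x‖ ≤ 2 * (c * e) * ‖leadingTerm θ₀ x‖ := by
  set A := Matrix.toEuclideanCLM (𝕜 := ℝ) (info θ₀)⁻¹ with hA
  set H := Matrix.toEuclideanCLM (𝕜 := ℝ) (info θ₀) with hHdef
  have hAH : ∀ v, A (H v) = v := fun v => by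
    have : A * H = 1 := by rw [hA, hHdef, ← map_mul, Matrix.nonsing_inv_mul _ hdet, map_one]
    exact congrArg (fun L => L v) this
  have hδ : 0 < δ := dist_nonneg.trans_lt hθ
  have h1 := norm_criterionGrad_sub_le hH (Metric.mem_ball_self hδ) hθ
  rw [hgrad, zero_sub] at h1
  set h := θ - θ₀ with hh
  set s := A (-criterionGrad x θ₀) with hs
  have h2 : ‖h - s‖ ≤ c * e * ‖h‖ := by
    have : h - s = -(A (-criterionGrad x θ₀ - H h)) := by rw [map_sub, hAH, neg_sub]
    rw [this, norm_neg, mul_assoc]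
    exact (A.le_opNorm _).trans (mul_le_mul hc h1 (norm_nonneg _) ((norm_nonneg _).trans hc))
  have hce0 : 0 ≤ c * e :=
    mul_nonneg ((norm_nonneg _).trans hc) ((norm_nonneg _).trans (hH θ₀ (Metric.mem_ball_self hδ)))
  have h3 : ‖h‖ ≤ 2 * ‖s‖ := by
    have h4 : ‖h‖ - ‖s‖ ≤ ‖h - s‖ := norm_sub_norm_le _ _
    nlinarith [norm_nonneg h]
  have h5 : ‖h - s‖ ≤ 2 * (c * e) * ‖s‖ := h2.trans (by nlinarith)
  rw [leadingTerm_eq hn, ← smul_sub, norm_smul, norm_smul, mul_left_comm]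
  exact mul_le_mul_of_nonneg_left h5 (norm_nonneg _)

/-! ### Removing the labels -/

theorem multivariateGaussian_unit_smul (z : ℤˣ) (θ : EuclideanSpace ℝ (Fin d)) :
    multivariateGaussian (((z : ℤ) : ℝ) • θ) 1 =
      (multivariateGaussian θ (1 : Matrix (Fin d) (Fin d) ℝ)).map
        fun x => ((z : ℤ) : ℝ) • x := by
  refine Measure.ext_of_charFun (funext fun t => ?_)
  rw [charFun_map_smul, charFun_multivariateGaussian Matrix.PosSemidef.one,
    charFun_multivariateGaussian Matrix.PosSemidef.one]
  rcases Int.units_eq_one_or z with rfl | rfl <;> simp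

theorem pi_multivariateGaussian_unit_smul (z : Fin n → ℤˣ) (θ : EuclideanSpace ℝ (Fin d)) :
    (Measure.pi fun i => multivariateGaussian (((z i : ℤ) : ℝ) • θ) 1) =
      (Measure.pi fun _ : Fin n => multivariateGaussian θ 1).map
        fun x i => ((z i : ℤ) : ℝ) • x i := by
  have hm : ∀ i, AEMeasurable (fun x : EuclideanSpace ℝ (Fin d) => ((z i : ℤ) : ℝ) • x)
      (multivariateGaussian θ 1) := fun i => by fun_prop
  have : ∀ i, SigmaFinite ((multivariateGaussian θ (1 : Matrix (Fin d) (Fin d) ℝ)).map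
      fun x => ((z i : ℤ) : ℝ) • x) := fun i => by
    rw [← multivariateGaussian_unit_smul]
    infer_instance
  rw [Measure.pi_map_pi hm]
  simp_rw [multivariateGaussian_unit_smul]

theorem sum_pmf_eq_one {α : Type*} [Fintype α] (Q : PMF α) : ∑ z, Q z = 1 := by
  rw [← tsum_fintype (L := .unconditional α), Q.tsum_coe]

instance isProbabilityMeasure_mixtureLaw (θ : EuclideanSpace ℝ (Fin d))
    (Q : PMF (Fin n → ℤˣ)) : IsProbabilityMeasure (mixtureLaw θ Q) :=
  ⟨by simp [mixtureLaw, sum_pmf_eq_one]⟩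

/-- A function that does not depend on the signs of the observations has the same law under
every distribution of the labels. -/
theorem map_mixtureLaw {β : Type*} [MeasurableSpace β] (θ : EuclideanSpace ℝ (Fin d))
    (Q : PMF (Fin n → ℤˣ)) {f : (Fin n → EuclideanSpace ℝ (Fin d)) → β} (hf : Measurable f)
    (heven : ∀ (z : Fin n → ℤˣ) x, f (fun i => ((z i : ℤ) : ℝ) • x i) = f x) :
    (mixtureLaw θ Q).map f = (Measure.pi fun _ : Fin n => multivariateGaussian θ 1).map f := by
  ext s hs
  rw [Measure.map_apply hf hs, Measure.map_apply hf hs, mixtureLaw, Measure.finsetSum_apply]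
  have h : ∀ z : Fin n → ℤˣ,
      (Q z • Measure.pi fun i => multivariateGaussian (((z i : ℤ) : ℝ) • θ) 1) (f ⁻¹' s) =
        Q z * (Measure.pi fun _ : Fin n => multivariateGaussian θ 1) (f ⁻¹' s) := by
    intro z
    rw [Measure.smul_apply, smul_eq_mul, pi_multivariateGaussian_unit_smul,
      Measure.map_apply (by fun_prop) (hf hs), ← Set.preimage_comp]
    congr 3
    exact funext fun x => heven z x
  simp_rw [h]
  rw [← Finset.sum_mul, sum_pmf_eq_one, one_mul]

theorem unit_smul_of_even {β : Type*} {φ : EuclideanSpace ℝ (Fin d) → β}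
    (hφ : ∀ x, φ (-x) = φ x) (z : ℤˣ) (x : EuclideanSpace ℝ (Fin d)) :
    φ (((z : ℤ) : ℝ) • x) = φ x := by
  rcases Int.units_eq_one_or z with rfl | rfl <;> simp [hφ]

/-! ### The law of large numbers -/

/-- The limit theorems concern one infinite sequence; this realises the samples of all sizes n as
its initial segments. -/
theorem pi_eq_map_infinitePi {E : Type*} [MeasurableSpace E] (μ : Measure E)
    [IsProbabilityMeasure μ] (n : ℕ) :
    (Measure.pi fun _ : Fin n => μ) =
      (Measure.infinitePi fun _ : ℕ => μ).map fun ω (i : Fin n) => ω i := by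
  have h : iIndepFun (fun (i : Fin n) (ω : ℕ → E) => ω i) (Measure.infinitePi fun _ => μ) :=
    (iIndepFun_infinitePi (P := fun _ : ℕ => μ) (X := fun _ x => x)
      fun _ => measurable_id).precomp (g := fun i : Fin n => (i : ℕ)) Fin.val_injective
  have hm : ∀ i : Fin n, AEMeasurable (fun ω : ℕ → E => ω i) (Measure.infinitePi fun _ => μ) :=
    fun i => (measurable_pi_apply (i : ℕ)).aemeasurable
  rw [(iIndepFun_iff_map_fun_eq_pi_map hm).1 h]
  congr 1
  exact funext fun i => (measurePreserving_eval_infinitePi (fun _ : ℕ => μ) (i : ℕ)).map_eq.symm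

theorem identDistrib_infinitePi {E β : Type*} [MeasurableSpace E] [MeasurableSpace β]
    (μ : Measure E) [IsProbabilityMeasure μ] {φ : E → β} (hφ : Measurable φ) (i : ℕ) :
    IdentDistrib (fun ω : ℕ → E => φ (ω i)) (fun ω => φ (ω 0))
      (Measure.infinitePi fun _ => μ) (Measure.infinitePi fun _ => μ) := by
  have h : ∀ j, (Measure.infinitePi fun _ : ℕ => μ).map (fun ω => φ (ω j)) = μ.map φ := by
    intro j
    conv_rhs => rw [← (measurePreserving_eval_infinitePi (fun _ : ℕ => μ) j).map_eq]
    exact (Measure.map_map hφ (measurable_pi_apply j)).symm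
  exact ⟨(hφ.comp (measurable_pi_apply i)).aemeasurable,
    (hφ.comp (measurable_pi_apply 0)).aemeasurable, by rw [h, h]⟩

theorem integral_comp_eval_infinitePi {E F : Type*} [MeasurableSpace E] [NormedAddCommGroup F]
    [NormedSpace ℝ F] (μ : Measure E) [IsProbabilityMeasure μ] {g : E → F}
    (hg : AEStronglyMeasurable g μ) (i : ℕ) :
    ∫ ω : ℕ → E, g (ω i) ∂(Measure.infinitePi fun _ => μ) = ∫ y, g y ∂μ := by
  have hpres := measurePreserving_eval_infinitePi (fun _ : ℕ => μ) i
  have hg' : AEStronglyMeasurable g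
      ((Measure.infinitePi fun _ : ℕ => μ).map (Function.eval i)) := by
    rwa [hpres.map_eq]
  conv_rhs => rw [← hpres.map_eq]
  exact (integral_map hpres.measurable.aemeasurable hg').symm

/-- The weak law of large numbers for even functions of the observations, with values in a
Banach space. -/
theorem tendsto_mixtureLaw_average {F : Type*} [NormedAddCommGroup F] [NormedSpace ℝ F]
    [CompleteSpace F] (θ : EuclideanSpace ℝ (Fin d)) (Q : (n : ℕ) → PMF (Fin n → ℤˣ))
    {φ : EuclideanSpace ℝ (Fin d) → F} (hφ : Continuous φ) (heven : ∀ x, φ (-x) = φ x)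
    (hint : Integrable φ (multivariateGaussian θ 1)) {ε : ℝ} (hε : 0 < ε) :
    Tendsto (fun n : ℕ => mixtureLaw θ (Q n) {x | ε ≤ ‖(1 / (n : ℝ)) • ∑ i, φ (x i) -
      ∫ y, φ y ∂(multivariateGaussian θ 1)‖}) atTop (𝓝 0) := by
  borelize F
  set γ := multivariateGaussian θ (1 : Matrix (Fin d) (Fin d) ℝ) with hγ
  have hpres := measurePreserving_eval_infinitePi (fun _ : ℕ => γ) 0
  have hlln := strong_law_ae (μ := Measure.infinitePi fun _ : ℕ => γ)
    (fun i ω => φ (ω i)) (hpres.integrable_comp_of_integrable hint)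
    (fun i j hij => (iIndepFun_infinitePi (P := fun _ : ℕ => γ) (X := fun _ => φ)
      fun _ => hφ.measurable).indepFun hij)
    (fun i => identDistrib_infinitePi γ hφ.measurable i)
  have hmean : ∫ ω, φ (ω 0) ∂(Measure.infinitePi fun _ : ℕ => γ) = ∫ y, φ y ∂γ :=
    integral_comp_eval_infinitePi γ hφ.aestronglyMeasurable 0
  rw [hmean] at hlln
  have hsm : ∀ i : ℕ, StronglyMeasurable fun ω : ℕ → EuclideanSpace ℝ (Fin d) => φ (ω i) :=
    fun i => (hφ.comp (continuous_apply i)).stronglyMeasurable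
  have hmeas := tendstoInMeasure_of_tendsto_ae (fun n => ((Finset.stronglyMeasurable_fun_sum
    (Finset.range n) fun i _ => hsm i).const_smul ((n : ℝ)⁻¹)).aestronglyMeasurable) hlln
  rw [tendstoInMeasure_iff_norm] at hmeas
  refine (hmeas ε hε).congr fun n => ?_
  set g : (Fin n → EuclideanSpace ℝ (Fin d)) → ℝ := fun x =>
    ‖(1 / (n : ℝ)) • ∑ i, φ (x i) - ∫ y, φ y ∂γ‖ with hg
  have hgm : Measurable g := by
    have : Continuous g := by fun_prop
    exact this.measurable
  have hgeven : ∀ (z : Fin n → ℤˣ) x, g (fun i => ((z i : ℤ) : ℝ) • x i) = g x := by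
    intro z x
    simp only [hg, unit_smul_of_even heven]
  have hlaw := congrArg (fun ν => ν (Set.Ici ε)) (map_mixtureLaw θ (Q n) hgm hgeven)
  rw [pi_eq_map_infinitePi, Measure.map_map hgm (by fun_prop)] at hlaw
  rw [Measure.map_apply hgm measurableSet_Ici,
    Measure.map_apply (hgm.comp (by fun_prop)) measurableSet_Ici] at hlaw
  refine Eq.trans ?_ hlaw.symm
  congr 1
  ext ω
  simp [hg, Finset.sum_range]

/-- The uniform weak law of large numbers on balls for even functions of the observations. -/
theorem tendsto_mixtureLaw_uniform {F : Type*} [NormedAddCommGroup F] [NormedSpace ℝ F]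
    [CompleteSpace F] (θ₀ : EuclideanSpace ℝ (Fin d)) (Q : (n : ℕ) → PMF (Fin n → ℤˣ))
    {φ : EuclideanSpace ℝ (Fin d) → EuclideanSpace ℝ (Fin d) → F}
    (hφ : Continuous fun p : EuclideanSpace ℝ (Fin d) × EuclideanSpace ℝ (Fin d) => φ p.1 p.2)
    (heven : ∀ θ x, φ θ (-x) = φ θ x) {R : ℝ} {B : EuclideanSpace ℝ (Fin d) → ℝ}
    (hB : Integrable B (multivariateGaussian θ₀ 1)) (hB0 : ∀ x, 0 ≤ B x)
    (hbound : ∀ θ x, ‖θ‖ ≤ R → ‖φ θ x‖ ≤ B x) :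
    ContinuousOn (fun θ => ∫ x, φ θ x ∂(multivariateGaussian θ₀ 1)) (Metric.closedBall 0 R) ∧
    ∀ ε : ℝ, 0 < ε → Tendsto (fun n : ℕ => mixtureLaw θ₀ (Q n) {x | ∃ θ, ‖θ‖ ≤ R ∧
      ε ≤ ‖(1 / (n : ℝ)) • ∑ i, φ θ (x i) - ∫ y, φ θ y ∂(multivariateGaussian θ₀ 1)‖})
      atTop (𝓝 0) := by
  set γ := multivariateGaussian θ₀ (1 : Matrix (Fin d) (Fin d) ℝ) with hγ
  let K := Metric.closedBall (0 : EuclideanSpace ℝ (Fin d)) R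
  have : CompactSpace K := isCompact_iff_compactSpace.1 (isCompact_closedBall 0 R)
  let Φ₀ : C(EuclideanSpace ℝ (Fin d) × K, F) :=
    ⟨fun p => φ p.2 p.1, hφ.comp (by fun_prop : Continuous fun
      p : EuclideanSpace ℝ (Fin d) × K => ((p.2 : EuclideanSpace ℝ (Fin d)), p.1))⟩
  -- The observation is mapped to the whole function θ ↦ φ(θ, x) on the compact ball. The
  -- Banach-valued law of large numbers in the sup norm is then uniform in θ, and the mean is
  -- automatically continuous.
  let Φ : EuclideanSpace ℝ (Fin d) → C(K, F) := fun x => Φ₀.curry x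
  have hΦ : Continuous Φ := Φ₀.curry.continuous
  have hΦapp : ∀ x (θ : K), Φ x θ = φ θ x := fun x θ => rfl
  have hΦint : Integrable Φ γ := hB.mono' hΦ.aestronglyMeasurable (ae_of_all _ fun x =>
    (ContinuousMap.norm_le _ (hB0 x)).2 fun θ => by
      rw [hΦapp]
      exact hbound θ x (mem_closedBall_zero_iff.1 θ.2))
  have heval : ∀ θ : K, (∫ x, Φ x ∂γ) θ = ∫ x, φ θ x ∂γ := fun θ =>
    ((ContinuousMap.evalCLM ℝ θ).integral_comp_comm hΦint).symm
  refine ⟨?_, fun ε hε => ?_⟩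
  · rw [continuousOn_iff_continuous_domRestrict]
    exact (∫ x, Φ x ∂γ).continuous.congr heval
  · have hΦeven : ∀ x, Φ (-x) = Φ x := fun x => ContinuousMap.ext fun θ => heven θ x
    refine tendsto_of_tendsto_of_tendsto_of_le_of_le tendsto_const_nhds
      (tendsto_mixtureLaw_average θ₀ Q hΦ hΦeven hΦint hε) (fun _ => zero_le)
      fun n => measure_mono ?_
    rintro x ⟨θ, hθ, h⟩
    refine h.trans ?_
    have hθK : θ ∈ K := mem_closedBall_zero_iff.2 hθ
    have h1 := ((1 / (n : ℝ)) • ∑ i, Φ (x i) - ∫ y, Φ y ∂γ).norm_coe_le_norm ⟨θ, hθK⟩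
    refine le_trans (le_of_eq ?_) h1
    rw [ContinuousMap.sub_apply, heval]
    simp [hΦapp]

/-! ### The central limit theorem for the leading term -/

theorem score_even (θ x : EuclideanSpace ℝ (Fin d)) : score θ (-x) = score θ x := by
  simp [score, Real.tanh_neg]

theorem curvature_even (θ x : EuclideanSpace ℝ (Fin d)) : curvature θ (-x) = curvature θ x := by
  ext1 v
  simp [curvature_apply, Real.cosh_neg]

theorem measurable_leadingTerm (θ : EuclideanSpace ℝ (Fin d)) :
    Measurable (leadingTerm θ : (Fin n → EuclideanSpace ℝ (Fin d)) → _) := by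
  have h := continuous_score θ
  have : Continuous fun x : Fin n → EuclideanSpace ℝ (Fin d) =>
      Matrix.toEuclideanCLM (𝕜 := ℝ) (info θ)⁻¹ ((1 / √(n : ℝ)) • ∑ i, score θ (x i)) := by
    fun_prop
  exact this.measurable

theorem leadingTerm_unit_smul (θ : EuclideanSpace ℝ (Fin d)) (z : Fin n → ℤˣ)
    (x : Fin n → EuclideanSpace ℝ (Fin d)) :
    leadingTerm θ (fun i => ((z i : ℤ) : ℝ) • x i) = leadingTerm θ x := by
  change Matrix.toEuclideanCLM (𝕜 := ℝ) (info θ)⁻¹ ((1 / √(n : ℝ)) •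
    ∑ i, score θ (((z i : ℤ) : ℝ) • x i)) = Matrix.toEuclideanCLM (𝕜 := ℝ) (info θ)⁻¹
      ((1 / √(n : ℝ)) • ∑ i, score θ (x i))
  simp only [unit_smul_of_even (score_even θ)]

theorem inner_toEuclideanCLM_comm {M : Matrix (Fin d) (Fin d) ℝ} (hM : M.IsHermitian)
    (v w : EuclideanSpace ℝ (Fin d)) :
    inner ℝ (Matrix.toEuclideanCLM (𝕜 := ℝ) M v) w =
      inner ℝ (Matrix.toEuclideanCLM (𝕜 := ℝ) M w) v := by
  have hT : M.transpose = M := by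
    rw [← Matrix.conjTranspose_eq_transpose_of_trivial]; exact hM
  rw [real_inner_comm, real_inner_comm v, Matrix.inner_toEuclideanCLM,
    Matrix.inner_toEuclideanCLM, Matrix.dotProduct_mulVec, ← Matrix.mulVec_transpose, hT,
    dotProduct_comm]

theorem inner_leadingTerm {θ : EuclideanSpace ℝ (Fin d)} (hθ : θ ≠ 0)
    (x : Fin n → EuclideanSpace ℝ (Fin d)) (t : EuclideanSpace ℝ (Fin d)) :
    inner ℝ (leadingTerm θ x) t = (√(n : ℝ))⁻¹ *
      ∑ i, inner ℝ (Matrix.toEuclideanCLM (𝕜 := ℝ) (info θ)⁻¹ t) (score θ (x i)) := by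
  rw [leadingTerm, inner_toEuclideanCLM_comm (posDef_info hθ).isHermitian.inv, inner_smul_right,
    one_div, inner_sum]
  rfl

/-- Frequency 1 suffices, because in the Cramér–Wold reduction the frequency vector is absorbed into
φ. -/
theorem tendsto_charFun_inv_sqrt_mul_sum {E : Type*} [MeasurableSpace E] (μ : Measure E)
    [IsProbabilityMeasure μ] {φ : E → ℝ} (hφ : Measurable φ) (hL2 : MemLp φ 2 μ)
    (hmean : ∫ y, φ y ∂μ = 0) :
    Tendsto (fun n : ℕ => charFun ((Measure.infinitePi fun _ : ℕ => μ).map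
      fun ω => (√(n : ℝ))⁻¹ * ∑ k ∈ Finset.range n, φ (ω k)) 1) atTop
      (𝓝 (charFun (gaussianReal 0 (∫ y, φ y ^ 2 ∂μ).toNNReal) 1)) := by
  set ν := Measure.infinitePi fun _ : ℕ => μ with hν
  have hpres := measurePreserving_eval_infinitePi (fun _ : ℕ => μ) 0
  have hL2' : MemLp (fun ω : ℕ → E => φ (ω 0)) 2 ν := hL2.comp_measurePreserving hpres
  have hmean' : ∫ ω, φ (ω 0) ∂ν = 0 :=
    (integral_comp_eval_infinitePi μ hφ.aestronglyMeasurable 0).trans hmean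
  have hvar : Var[fun ω => φ (ω 0); ν] = ∫ y, φ y ^ 2 ∂μ := by
    rw [variance_of_integral_eq_zero hL2'.aemeasurable hmean']
    exact integral_comp_eval_infinitePi μ (hφ.pow_const 2).aestronglyMeasurable 0
  have hlaw : HasLaw id (gaussianReal 0 Var[fun ω => φ (ω 0); ν].toNNReal)
      (gaussianReal 0 (∫ y, φ y ^ 2 ∂μ).toNNReal) := by
    rw [hvar]
    exact HasLaw.id
  have hclt := tendstoInDistribution_inv_sqrt_mul_sum_sub (P := ν)
    (X := fun k ω => φ (ω k)) hlaw hL2' (iIndepFun_infinitePi (P := fun _ : ℕ => μ) (X := fun _ => φ) fun _ => hφ)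
    (fun i => identDistrib_infinitePi μ hφ i)
  have hchar := ProbabilityMeasure.tendsto_iff_tendsto_charFun.1 hclt.tendsto 1
  simp only [ProbabilityMeasure.coe_mk, Measure.map_id, hmean', mul_zero, sub_zero] at hchar
  exact hchar

/-- By symmetry of I₀⁻¹ the projection on t is a normalised sum of uᵀ score with u = I₀⁻¹t, whose
variance is uᵀI₀u = tᵀI₀⁻¹t. -/
theorem tendsto_charFun_leadingTerm {θ : EuclideanSpace ℝ (Fin d)} (hθ : θ ≠ 0)
    (Q : (n : ℕ) → PMF (Fin n → ℤˣ)) (t : EuclideanSpace ℝ (Fin d)) :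
    Tendsto (fun n : ℕ => charFun ((mixtureLaw θ (Q n)).map (leadingTerm θ)) t) atTop
      (𝓝 (charFun (multivariateGaussian 0 (info θ)⁻¹) t)) := by
  have hpd := posDef_info hθ
  set u := Matrix.toEuclideanCLM (𝕜 := ℝ) (info θ)⁻¹ t with hu
  have hφ : Continuous fun x => inner ℝ u (score θ x) :=
    continuous_const.inner (continuous_score θ)
  have hAinv : Matrix.toEuclideanCLM (𝕜 := ℝ) (info θ) u = t := by
    have : Matrix.toEuclideanCLM (𝕜 := ℝ) (info θ) * Matrix.toEuclideanCLM (𝕜 := ℝ) (info θ)⁻¹ =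
        1 := by
      rw [← map_mul, Matrix.mul_nonsing_inv _ ((Matrix.isUnit_iff_isUnit_det _).1 hpd.isUnit),
        map_one]
    exact congrArg (fun L => L t) this
  have hchar := tendsto_charFun_inv_sqrt_mul_sum (multivariateGaussian θ 1) hφ.measurable
    (memLp_inner_score θ u) (integral_inner_score θ u)
  have hnonneg : 0 ≤ ∫ y, inner ℝ u (score θ y) ^ 2 ∂(multivariateGaussian θ 1) :=
    integral_nonneg fun _ => sq_nonneg _
  have hlim : charFun (gaussianReal 0
      (∫ y, inner ℝ u (score θ y) ^ 2 ∂(multivariateGaussian θ 1)).toNNReal) 1 =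
      charFun (multivariateGaussian 0 (info θ)⁻¹) t := by
    rw [charFun_gaussianReal, charFun_multivariateGaussian hpd.inv.posSemidef,
      Real.coe_toNNReal _ hnonneg, integral_inner_score_sq, hAinv, real_inner_comm, hu,
      Matrix.inner_toEuclideanCLM]
    simp
  rw [hlim] at hchar
  refine hchar.congr fun n => ?_
  have hLm := measurable_leadingTerm (n := n) θ
  have hsum : Measurable fun ω : ℕ → EuclideanSpace ℝ (Fin d) =>
      (√(n : ℝ))⁻¹ * ∑ k ∈ Finset.range n, inner ℝ u (score θ (ω k)) := by
    have : Continuous fun ω : ℕ → EuclideanSpace ℝ (Fin d) =>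
        (√(n : ℝ))⁻¹ * ∑ k ∈ Finset.range n, inner ℝ u (score θ (ω k)) :=
      continuous_const.mul (continuous_finsetSum _ fun k _ => hφ.comp (continuous_apply k))
    exact this.measurable
  rw [map_mixtureLaw θ (Q n) hLm (leadingTerm_unit_smul θ), pi_eq_map_infinitePi,
    Measure.map_map hLm (by fun_prop), charFun_apply, charFun_apply,
    integral_map (hLm.comp (by fun_prop)).aemeasurable (by fun_prop),
    integral_map hsum.aemeasurable (by fun_prop)]
  refine integral_congr_ae (ae_of_all _ fun ω => ?_)
  simp only [Function.comp_apply]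
  rw [inner_leadingTerm hθ, Finset.sum_range]
  simp [hu]

theorem tendstoInDistribution_leadingTerm {θ : EuclideanSpace ℝ (Fin d)} (hθ : θ ≠ 0)
    (Q : (n : ℕ) → PMF (Fin n → ℤˣ)) {Ω' : Type*} [MeasurableSpace Ω'] {μ : Measure Ω'}
    [IsProbabilityMeasure μ] {Y : (n : ℕ) → Ω' → Fin n → EuclideanSpace ℝ (Fin d)}
    (hY : ∀ n, HasLaw (Y n) (mixtureLaw θ (Q n)) μ) :
    TendstoInDistribution (fun n ω => leadingTerm θ (Y n ω)) atTop
      (id : EuclideanSpace ℝ (Fin d) → EuclideanSpace ℝ (Fin d)) (fun _ => μ)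
      (multivariateGaussian 0 (info θ)⁻¹) where
  forall_aemeasurable n := (measurable_leadingTerm θ).comp_aemeasurable (hY n).aemeasurable
  tendsto := by
    refine ProbabilityMeasure.tendsto_iff_tendsto_charFun.2 fun t => ?_
    simp only [ProbabilityMeasure.coe_mk, Measure.map_id]
    refine (tendsto_charFun_leadingTerm hθ Q t).congr fun n => ?_
    rw [← (hY n).map_eq, AEMeasurable.map_map_of_aemeasurable
      (measurable_leadingTerm θ).aemeasurable (hY n).aemeasurable]
    rfl

/-- The leading term is bounded in probability. -/
theorem exists_mixtureLaw_norm_leadingTerm_gt_le {θ : EuclideanSpace ℝ (Fin d)} (hθ : θ ≠ 0)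
    (Q : (n : ℕ) → PMF (Fin n → ℤˣ)) {κ : ENNReal} (hκ : 0 < κ) :
    ∃ r : ℝ, 0 < r ∧ ∀ n, mixtureLaw θ (Q n) {x | r < ‖leadingTerm θ x‖} ≤ κ := by
  have : ∀ n, IsProbabilityMeasure ((mixtureLaw θ (Q n)).map (leadingTerm θ)) := fun n =>
    Measure.isProbabilityMeasure_map (measurable_leadingTerm θ).aemeasurable
  -- Pointwise convergence of characteristic functions to a limit continuous at 0 makes the whole
  -- sequence tight, so one radius serves every n.
  have htight := isTightMeasureSet_of_tendsto_charFun
    (μ := fun n => (mixtureLaw θ (Q n)).map (leadingTerm θ))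
    (continuous_charFun (μ := multivariateGaussian 0 (info θ)⁻¹)).continuousAt
    (tendsto_charFun_leadingTerm hθ Q)
  have h := tendsto_measure_norm_gt_of_isTightMeasureSet htight
  rw [ENNReal.tendsto_nhds_zero] at h
  obtain ⟨r, hr, hr0⟩ := ((h κ hκ).and (eventually_gt_atTop 0)).exists
  refine ⟨r, hr0, fun n => ?_⟩
  have h1 := (le_iSup₂ (f := fun (μ : Measure (EuclideanSpace ℝ (Fin d)))
    (_ : μ ∈ Set.range fun n => (mixtureLaw θ (Q n)).map (leadingTerm θ)) => μ {x | r < ‖x‖})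
    _ (Set.mem_range_self n)).trans hr
  rwa [Measure.map_apply (measurable_leadingTerm θ)
    (measurableSet_lt measurable_const measurable_norm)] at h1

/-! ### The minimiser -/

theorem zero_notMem_halfSpace : (0 : EuclideanSpace ℝ (Fin d)) ∉ halfSpace d := by
  rintro ⟨k, hk, -⟩
  simp at hk

/-- On the compact ball without the δ-balls around ±θ₀ the population criterion attains a minimum
strictly above its value at θ₀. Half of that gap is η: errors below η at two points cannot close it.
-/
theorem exists_separation {θ₀ : EuclideanSpace ℝ (Fin d)} {R δ : ℝ} (hδ : 0 < δ)
    (hcont : ContinuousOn (populationCriterion θ₀) (Metric.closedBall 0 R)) :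
    ∃ η : ℝ, 0 < η ∧ ∀ θ : EuclideanSpace ℝ (Fin d), ‖θ‖ ≤ R → δ ≤ ‖θ - θ₀‖ → δ ≤ ‖θ + θ₀‖ →
      populationCriterion θ₀ θ₀ + 2 * η ≤ populationCriterion θ₀ θ := by
  set S : Set (EuclideanSpace ℝ (Fin d)) :=
    Metric.closedBall 0 R ∩ ({θ | δ ≤ ‖θ - θ₀‖} ∩ {θ | δ ≤ ‖θ + θ₀‖}) with hS
  have hScompact : IsCompact S := (isCompact_closedBall _ _).inter_right
    ((isClosed_le continuous_const (by fun_prop)).inter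
      (isClosed_le continuous_const (by fun_prop)))
  rcases S.eq_empty_or_nonempty with hemp | hne
  · refine ⟨1, one_pos, fun θ h1 h2 h3 => ?_⟩
    have : θ ∈ S := ⟨mem_closedBall_zero_iff.2 h1, h2, h3⟩
    simp [hemp] at this
  · obtain ⟨θ₁, ⟨-, h1, h2⟩, hmin⟩ := hScompact.exists_isMinOn hne
      (hcont.mono Set.inter_subset_left)
    have hlt : populationCriterion θ₀ θ₀ < populationCriterion θ₀ θ₁ := by
      apply populationCriterion_lt
      · rintro rfl
        simp only [Set.mem_ofPred_eq, sub_self, norm_zero] at h1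
        linarith
      · rintro rfl
        simp only [Set.mem_ofPred_eq, neg_add_cancel, norm_zero] at h2
        linarith
    refine ⟨(populationCriterion θ₀ θ₁ - populationCriterion θ₀ θ₀) / 2, by linarith,
      fun θ h3 h4 h5 => ?_⟩
    have : populationCriterion θ₀ θ₁ ≤ populationCriterion θ₀ θ :=
      hmin ⟨mem_closedBall_zero_iff.2 h3, h4, h5⟩
    linarith

/-- With probability tending to one the minimiser over the half-space is unique and its
standardised error is the leading term up to an arbitrarily small relative error. -/
theorem tendsto_mixtureLaw_not_expansion {θ₀ : EuclideanSpace ℝ (Fin d)}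
    (hθ₀ : θ₀ ∈ interior (halfSpace d)) (Q : (n : ℕ) → PMF (Fin n → ℤˣ)) {ρ : ℝ} (hρ : 0 < ρ) :
    Tendsto (fun n : ℕ => mixtureLaw θ₀ (Q n) {x | ¬ ∃ θ, (∀ θ', IsMinimiser x θ' ↔ θ' = θ) ∧
      ‖√(n : ℝ) • (θ - θ₀) - leadingTerm θ₀ x‖ ≤ ρ * ‖leadingTerm θ₀ x‖}) atTop (𝓝 0) := by
  have hne : θ₀ ≠ 0 := fun h => zero_notMem_halfSpace (h ▸ interior_subset hθ₀)
  have hpd := posDef_info hne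
  have hdet : IsUnit (info θ₀).det := (Matrix.isUnit_iff_isUnit_det _).1 hpd.isUnit
  set γ := multivariateGaussian θ₀ (1 : Matrix (Fin d) (Fin d) ℝ) with hγ
  obtain ⟨δ₀, hδ₀, hball⟩ := Metric.mem_nhds_iff.1 (mem_interior_iff_mem_nhds.1 hθ₀)
  set A := Matrix.toEuclideanCLM (𝕜 := ℝ) (info θ₀)⁻¹ with hA
  set H := Matrix.toEuclideanCLM (𝕜 := ℝ) (info θ₀) with hH
  have hAH : ∀ v, A (H v) = v := fun v => by
    have : A * H = 1 := by rw [hA, hH, ← map_mul, Matrix.nonsing_inv_mul _ hdet, map_one]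
    exact congrArg (fun L => L v) this
  set c := ‖A‖ + 1 with hc
  have hc0 : 0 < c := by positivity
  have hAc : ‖A‖ ≤ c := by simp [hc]
  -- This makes c e ≤ 1/2, as uniqueness and the expansion require, and 2 c e ≤ ρ, the desired
  -- relative error.
  set e := min ρ 1 / (2 * c) with he
  have he0 : 0 < e := by positivity
  have hce : c * e = min ρ 1 / 2 := by rw [he]; field_simp
  have hm1 : min ρ 1 ≤ 1 := min_le_right _ _
  have hmρ : min ρ 1 ≤ ρ := min_le_left _ _
  set C := (∫ x, ‖x‖ ∂γ) + 1 with hC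
  -- The bound 2C is for coercivity; ‖θ₀‖ + 1 keeps the δ-ball around θ₀, with δ ≤ 1, inside the
  -- ball of uniform convergence.
  set R := max (2 * C) (‖θ₀‖ + 1) with hR
  have hθR : ‖θ₀‖ + 1 ≤ R := le_max_right _ _
  have hR0 : 0 ≤ R := by linarith [norm_nonneg θ₀]
  have hnormint : Integrable (fun x => ‖x‖) γ := (integrable_id_multivariateGaussian θ₀).norm
  obtain ⟨hLcont, hLlim⟩ := tendsto_mixtureLaw_uniform θ₀ Q
    (φ := fun θ x => Real.log (Real.cosh (inner ℝ θ x)))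
    (continuous_log_cosh.comp (by fun_prop)) (fun θ x => by simp) (R := R)
    (hnormint.const_mul R) (fun x => by positivity) (fun θ x hθ => by
      rw [Real.norm_of_nonneg (log_cosh_nonneg _)]
      exact (log_cosh_inner_le θ x).trans (by gcongr))
  obtain ⟨hDcont, hDlim⟩ := tendsto_mixtureLaw_uniform θ₀ Q (φ := curvature)
    continuous_curvature curvature_even (R := R)
    (integrable_norm_pow_multivariateGaussian θ₀ 2) (fun x => by positivity)
    (fun θ x _ => norm_curvature_le θ x)
  obtain ⟨δ₁, hδ₁, hD⟩ : ∃ δ₁ > 0, ∀ θ ∈ Metric.ball θ₀ δ₁,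
      ‖∫ x, curvature θ x ∂γ - ∫ x, curvature θ₀ x ∂γ‖ < e / 2 := by
    have hnhds : Metric.closedBall (0 : EuclideanSpace ℝ (Fin d)) R ∈ 𝓝 θ₀ :=
      Metric.closedBall_mem_nhds_of_mem (by rw [mem_ball_zero_iff]; linarith)
    obtain ⟨δ₁, hδ₁, h⟩ := Metric.continuousAt_iff.1 (hDcont.continuousAt hnhds) (e / 2)
      (by positivity)
    exact ⟨δ₁, hδ₁, fun θ hθ => by simpa [dist_eq_norm] using h hθ⟩
  set δ := min (min δ₀ δ₁) 1 with hδ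
  have hδ0 : 0 < δ := by positivity
  have hδle0 : δ ≤ δ₀ := (min_le_left _ _).trans (min_le_left _ _)
  have hδle1 : δ ≤ δ₁ := (min_le_left _ _).trans (min_le_right _ _)
  have hδle : δ ≤ 1 := min_le_right _ _
  have hpcont : ContinuousOn (populationCriterion θ₀) (Metric.closedBall 0 R) :=
    ContinuousOn.sub (by fun_prop) hLcont
  obtain ⟨η, hη, hsep⟩ := exists_separation hδ0 hpcont
  -- The bad event is covered by three: a large mean norm, a criterion off by η, a Hessian off by
  -- e/2. The other e/2 goes to the variation of the population Hessian on the δ-ball.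
  have hlim := ((tendsto_mixtureLaw_average θ₀ Q continuous_norm (fun x => norm_neg x)
    hnormint one_pos).add (hLlim η hη)).add (hDlim (e / 2) (by positivity))
  simp only [add_zero] at hlim
  refine tendsto_of_tendsto_of_tendsto_of_le_of_le' tendsto_const_nhds hlim
    (Eventually.of_forall fun _ => zero_le) ?_
  filter_upwards [eventually_ne_atTop 0] with n hn
  refine le_trans (measure_mono ?_) ((measure_union_le _ _).trans
    (add_le_add_left (measure_union_le _ _) _))
  intro x hx
  by_contra hgood
  simp only [Set.mem_union, Set.mem_ofPred_eq, not_or, not_exists, not_and, not_le] at hgood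
  obtain ⟨⟨h1, h2⟩, h3⟩ := hgood
  refine hx ?_
  have hmean : (1 / (n : ℝ)) * ∑ i, ‖x i‖ ≤ C := by
    have := (abs_lt.1 h1).2
    rw [smul_eq_mul] at this
    linarith
  have hcrit : ∀ θ : EuclideanSpace ℝ (Fin d), ‖θ‖ ≤ R →
      |criterion x θ - populationCriterion θ₀ θ| < η := fun θ hθ => by
    have := h2 θ hθ
    rw [Real.norm_eq_abs, abs_sub_comm, smul_eq_mul] at this
    simpa [criterion, populationCriterion] using this
  have hhess : ∀ θ ∈ Metric.ball θ₀ δ, ‖(ContinuousLinearMap.id ℝ _ -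
      (1 / (n : ℝ)) • ∑ i, curvature θ (x i)) - H‖ ≤ e := fun θ hθ => by
    have hθn : ‖θ‖ ≤ R := by
      have h4 := norm_sub_norm_le θ θ₀
      rw [mem_ball_iff_norm] at hθ
      linarith
    have h5 := h3 θ hθn
    have h6 := hD θ (Metric.ball_subset_ball hδle1 hθ)
    have h7 : (ContinuousLinearMap.id ℝ _ - (1 / (n : ℝ)) • ∑ i, curvature θ (x i)) - H =
        -((1 / (n : ℝ)) • ∑ i, curvature θ (x i) - ∫ y, curvature θ y ∂γ) -
        (∫ y, curvature θ y ∂γ - ∫ y, curvature θ₀ y ∂γ) := by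
      rw [hH, toEuclideanCLM_info]
      abel
    rw [h7]
    refine (norm_sub_le _ _).trans ?_
    rw [norm_neg]
    linarith
  obtain ⟨θ, hθ, hgrad, hmin⟩ := exists_unique_isMinimiser hR0 (by linarith) (le_max_left _ _)
    hmean hcrit hsep ((Metric.ball_subset_ball hδle0).trans hball) hhess (c := c)
    (fun v => by
      conv_lhs => rw [← hAH v]
      exact (A.le_opNorm _).trans (by gcongr)) hc0.le (by linarith)
  refine ⟨θ, hmin, ?_⟩
  refine (norm_expansion_le hn hdet hhess hAc (by linarith) hθ hgrad).trans ?_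
  gcongr
  linarith

theorem tendsto_mixtureLaw_expansion {θ₀ : EuclideanSpace ℝ (Fin d)}
    (hθ₀ : θ₀ ∈ interior (halfSpace d)) (Q : (n : ℕ) → PMF (Fin n → ℤˣ))
    {θhat : (n : ℕ) → (Fin n → EuclideanSpace ℝ (Fin d)) → EuclideanSpace ℝ (Fin d)}
    (hθhat : ∀ n x, (∃ θ, IsMinimiser x θ) → IsMinimiser x (θhat n x)) {ε : ℝ} (hε : 0 < ε) :
    Tendsto (fun n : ℕ => mixtureLaw θ₀ (Q n)
      {x | ε ≤ ‖√(n : ℝ) • (θhat n x - θ₀) - leadingTerm θ₀ x‖}) atTop (𝓝 0) := by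
  have hne : θ₀ ≠ 0 := fun h => zero_notMem_halfSpace (h ▸ interior_subset hθ₀)
  rw [ENNReal.tendsto_nhds_zero]
  intro κ hκ
  have hκ2 : 0 < κ / 2 := ENNReal.half_pos hκ.ne'
  obtain ⟨r, hr, hbdd⟩ := exists_mixtureLaw_norm_leadingTerm_gt_le hne Q hκ2
  -- Where the leading term is at most r, a relative error ε/(2r) leaves an absolute error of at
  -- most ε/2 < ε.
  have hρ : 0 < ε / (2 * r) := by positivity
  have h := tendsto_mixtureLaw_not_expansion hθ₀ Q hρ
  rw [ENNReal.tendsto_nhds_zero] at h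
  filter_upwards [h _ hκ2] with n hn
  rw [← ENNReal.add_halves κ]
  refine le_trans (measure_mono ?_) ((measure_union_le _ _).trans (add_le_add hn (hbdd n)))
  intro x hx
  by_contra hgood
  simp only [Set.mem_union, Set.mem_ofPred_eq, not_or, not_not, not_lt] at hgood
  obtain ⟨⟨θ, hmin, hexp⟩, hle⟩ := hgood
  have hθ : θhat n x = θ := (hmin _).1 (hθhat n x ⟨θ, (hmin θ).2 rfl⟩)
  rw [Set.mem_ofPred_eq, hθ] at hx
  have h1 : ε / (2 * r) * ‖leadingTerm θ₀ x‖ ≤ ε / (2 * r) * r := by gcongr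
  have h2 : ε / (2 * r) * r = ε / 2 := by field_simp
  linarith

theorem tendstoInDistribution_estimator {θ₀ : EuclideanSpace ℝ (Fin d)}
    (hθ₀ : θ₀ ∈ interior (halfSpace d)) (Q : (n : ℕ) → PMF (Fin n → ℤˣ))
    {Ω : ℕ → Type*} [∀ n, MeasurableSpace (Ω n)]
    (P : (n : ℕ) → Measure (Ω n)) [∀ n, IsProbabilityMeasure (P n)]
    {X : (n : ℕ) → Ω n → Fin n → EuclideanSpace ℝ (Fin d)}
    (hX : ∀ n, HasLaw (X n) (mixtureLaw θ₀ (Q n)) (P n))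
    {θhat : (n : ℕ) → (Fin n → EuclideanSpace ℝ (Fin d)) → EuclideanSpace ℝ (Fin d)}
    (hmeas : ∀ n, Measurable (θhat n))
    (hθhat : ∀ n x, (∃ θ, IsMinimiser x θ) → IsMinimiser x (θhat n x)) :
    TendstoInDistribution (fun (n : ℕ) ω => √(n : ℝ) • (θhat n (X n ω) - θ₀)) atTop
      (id : EuclideanSpace ℝ (Fin d) → EuclideanSpace ℝ (Fin d)) P
      (multivariateGaussian 0 (info θ₀)⁻¹) := by
  have hne : θ₀ ≠ 0 := fun h => zero_notMem_halfSpace (h ▸ interior_subset hθ₀)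
  -- Slutsky's lemma is applied on a single space, while the samples live on different spaces `Ω n`.
  -- Convergence in distribution depends only on the marginal laws, so all of them are realised on
  -- the product.
  set ν := Measure.infinitePi fun n => mixtureLaw θ₀ (Q n) with hν
  have hpres := fun n => measurePreserving_eval_infinitePi (fun n => mixtureLaw θ₀ (Q n)) n
  have hest : ∀ n : ℕ, Measurable fun x : Fin n → EuclideanSpace ℝ (Fin d) =>
      √(n : ℝ) • (θhat n x - θ₀) := fun n => by
    have := hmeas n
    fun_prop
  have hD : ∀ n : ℕ, Measurable fun x : Fin n → EuclideanSpace ℝ (Fin d) =>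
      ‖√(n : ℝ) • (θhat n x - θ₀) - leadingTerm θ₀ x‖ := fun n =>
    ((hest n).sub (measurable_leadingTerm θ₀)).norm
  have hlead := tendstoInDistribution_leadingTerm hne Q (μ := ν) (Y := fun n ω => ω n)
    fun n => (hpres n).hasLaw
  have hsub : TendstoInMeasure ν ((fun (n : ℕ) ω => √(n : ℝ) • (θhat n (ω n) - θ₀)) -
      fun n ω => leadingTerm θ₀ (ω n)) atTop 0 := by
    rw [tendstoInMeasure_iff_norm]
    intro ε hε
    refine (tendsto_mixtureLaw_expansion hθ₀ Q hθhat hε).congr fun n => ?_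
    rw [← (hpres n).measure_preimage
      (measurableSet_le measurable_const (hD n)).nullMeasurableSet]
    congr 1
    ext ω
    simp
  have h := tendstoInDistribution_of_tendstoInMeasure_sub _ _ hlead hsub
    fun n => ((hest n).comp (measurable_pi_apply n)).aemeasurable
  refine ⟨fun n => (hest n).comp_aemeasurable (hX n).aemeasurable, measurable_id.aemeasurable, ?_⟩
  refine h.tendsto.congr fun n => Subtype.ext ?_
  simp only
  have e1 := Measure.map_map (μ := ν) (hest n) (measurable_pi_apply n)
  have e2 := AEMeasurable.map_map_of_aemeasurable (hest n).aemeasurable (hX n).aemeasurable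
  rw [(hX n).map_eq] at e2
  have e3 : ν.map (fun ω => ω n) = mixtureLaw θ₀ (Q n) := (hpres n).map_eq
  rw [e3] at e1
  exact e1.symm.trans e2

end LabelMixture

theorem theorem1 {d : ℕ} (θ₀ : EuclideanSpace ℝ (Fin d))
    (hθ₀ : θ₀ ∈ interior (LabelMixture.halfSpace d))
    (Q : (n : ℕ) → PMF (Fin n → ℤˣ))
    {Ω : ℕ → Type*} [∀ n, MeasurableSpace (Ω n)]
    (P : (n : ℕ) → Measure (Ω n)) [∀ n, IsProbabilityMeasure (P n)]
    (X : (n : ℕ) → Ω n → Fin n → EuclideanSpace ℝ (Fin d))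
    (hX : ∀ n, HasLaw (X n) (LabelMixture.mixtureLaw θ₀ (Q n)) (P n))
    (θhat : (n : ℕ) → (Fin n → EuclideanSpace ℝ (Fin d)) → EuclideanSpace ℝ (Fin d))
    (hθhat_meas : ∀ n, Measurable (θhat n))
    (hθhat : ∀ n x, (∃ θ, LabelMixture.IsMinimiser x θ) →
      LabelMixture.IsMinimiser x (θhat n x)) :
    -- the minimiser exists and is unique with probability tending to one
    Tendsto (fun n => P n {ω | ¬ ∃! θ, LabelMixture.IsMinimiser (X n ω) θ}) atTop (𝓝 0) ∧
    -- the information matrix is positive definite, hence invertible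
    (LabelMixture.info θ₀).PosDef ∧
    -- the linear expansion with an error that tends to zero in probability
    (∀ ε : ℝ, 0 < ε →
      Tendsto (fun n : ℕ => P n {ω | ε ≤ ‖√(n : ℝ) • (θhat n (X n ω) - θ₀) -
        LabelMixture.leadingTerm θ₀ (X n ω)‖}) atTop (𝓝 0)) ∧
    -- asymptotic normality
    TendstoInDistribution (fun (n : ℕ) ω => √(n : ℝ) • (θhat n (X n ω) - θ₀)) atTop
      (id : EuclideanSpace ℝ (Fin d) → EuclideanSpace ℝ (Fin d)) P
      (multivariateGaussian 0 (LabelMixture.info θ₀)⁻¹) := by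
  have hne : θ₀ ≠ 0 := fun h =>
    LabelMixture.zero_notMem_halfSpace (h ▸ interior_subset hθ₀)
  -- The inequality between the measure of a preimage and the image measure holds for arbitrary
  -- sets, so the non-uniqueness event need not be shown measurable.
  have htransfer : ∀ S : (n : ℕ) → Set (Fin n → EuclideanSpace ℝ (Fin d)),
      Tendsto (fun n => LabelMixture.mixtureLaw θ₀ (Q n) (S n)) atTop (𝓝 0) →
      Tendsto (fun n => P n (X n ⁻¹' S n)) atTop (𝓝 0) := fun S hS =>
    tendsto_of_tendsto_of_tendsto_of_le_of_le tendsto_const_nhds hS (fun _ => zero_le)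
      fun n => (Measure.le_map_apply (hX n).aemeasurable (S n)).trans_eq (by rw [(hX n).map_eq])
  refine ⟨?_, LabelMixture.posDef_info hne, fun ε hε => ?_,
    LabelMixture.tendstoInDistribution_estimator hθ₀ Q P hX hθhat_meas hθhat⟩
  · refine htransfer (fun n => {x | ¬ ∃! θ, LabelMixture.IsMinimiser x θ}) ?_
    refine tendsto_of_tendsto_of_tendsto_of_le_of_le tendsto_const_nhds
      (LabelMixture.tendsto_mixtureLaw_not_expansion hθ₀ Q one_pos) (fun _ => zero_le)
      fun n => measure_mono fun x hx h => hx ?_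
    obtain ⟨θ, hθ, -⟩ := h
    exact ⟨θ, (hθ θ).2 rfl, fun θ' h' => (hθ θ').1 h'⟩
  · exact htransfer (fun n => {x | ε ≤ ‖√(n : ℝ) • (θhat n x - θ₀) -
      LabelMixture.leadingTerm θ₀ x‖}) (LabelMixture.tendsto_mixtureLaw_expansion hθ₀ Q hθhat hε)
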